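/- Work over $\mathbb C$. Let $\mathscr C\subset\mathbb P^2$ be a plane curve $F(x,y,z)=0$ ($F\neq 0$ homogeneous of degree $d$, possibly non-reduced) through $p=(1:0:0)$, and let $$\alpha(t)=\begin{pmatrix}1&0&0\\ q(t)&t^b&0\\ r(t)&s(t)t^b&t^c\end{pmatrix},\qquad 1\le b\le c,$$ where $q,r,s\in\mathbb C[t]$ are not all zero, $q(0)=r(0)=s(0)=0$, $\deg q<b$, $\deg r<c$, $\deg s<c-b$ (with $\deg 0=-\infty$), and, if $b=c$ and $q,r$ are not both zero, $v(q)<v(r)$, where $v$ is the order of vanishing at $0$ ($v(0)=+\infty$). The limit $\lim_{t\to0}\mathscr C\circ\alpha(t)$ is the curve defined by the form obtained from $F(\alpha(t)(x,y,z))$ by clearing the common power of $t$ and setting $t=0$. Consider the rational map $A\mapsto F\circ A$ from the $\mathbb P^8$ of $3\times3$ matrices to the $\mathbb P^N$ of degree-$d$ curves, with base scheme $\mathscr S$ (supported on $\{A: F\circ A\equiv0\}$); the closure of its graph is the blow-up of $\mathbb P^8$ along $\mathscr S$. A curve is a *rank-2 limit* of $\mathscr C$ if it lies in the image in $\mathbb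 P^N$ of the intersection of the exceptional divisor with the proper transform of the locus of singular matrices. Two germs $\alpha,\beta$ of matrices over $\mathbb C[[t]]$ are *equivalent* if $\beta(t\nu(t))=\alpha(t)\,m(t)$ as germs in $\mathbb P^8$, for a unit $\nu\in\mathbb C[[t]]$ and a matrix $m$ over $\mathbb C[[t]]$ with $m(0)=I$. Suppose that $\lim_{t\to 0}\mathscr C\circ\alpha(t)$ is not a rank-2 limit of $\mathscr C$. Then $q\ne 0$ and, with $a=v(q)$, we have $0<a<b<c$, and $\mathscr C$ has at $p$ a formal branch $z=f(y)$ tangent to $z=0$, that is, a Puiseux series $f=\sum_k\gamma_{\lambda_k}y^{\lambda_k}\neq0$ with $F(1,y,f(y))=0$, $1<\lambda_0<\lambda_1<\cdots$ and $\gamma_{\lambda_k}\ne0$, such that the following holds. The truncations $\underline{f(t^a)}$ and $\underline{f'(t^a)t^b}$ modulo $t^c$ are polynomials, and there is a constant invertible matrix $M$, with $M=I$ if $q=t^a$, such that $\alpha$ is equivalent to $$\begin{pmatrix}1&0&0\\ t^a&t^b&0\\ \underline{f(t^a)}&\underline{f'(t^a)t^b}&t^c\end{pmatrix}\cdot M .$$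 Moreover, for the same branch, $\dfrac ca\le\lambda_0+2\left(\dfrac ba-1\right)$. -/

import Mathlib

open scoped Matrix Polynomial

/-! ### Plane curves, germs of matrices, limits -/

/-- The form `F(α(x, y, z))`, for a ternary form `F` over `ℂ` and a `3 × 3` matrix `α` over a
`ℂ`-algebra `R`: the variable `X i` is replaced by `∑ j, α i j * X j`. -/
noncomputable def pullback {R : Type*} [CommRing R] [Algebra ℂ R]
    (F : MvPolynomial (Fin 3) ℂ) (α : Matrix (Fin 3) (Fin 3) R) : MvPolynomial (Fin 3) R :=
  MvPolynomial.aeval (fun i => ∑ j, MvPolynomial.C (α i j) * MvPolynomial.X j) F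

/-- `G = 0` is the limit as `t → 0` of the family of curves `F(α(t)(x, y, z)) = 0`: after clearing
the common power `t ^ w` from `F ∘ α(t)`, setting `t = 0` gives the nonzero form `G`. -/
def IsFlatLimit (F : MvPolynomial (Fin 3) ℂ) (α : Matrix (Fin 3) (Fin 3) (PowerSeries ℂ))
    (G : MvPolynomial (Fin 3) ℂ) : Prop :=
  G ≠ 0 ∧ ∃ (w : ℕ) (H : MvPolynomial (Fin 3) (PowerSeries ℂ)),
    pullback F α = MvPolynomial.C (PowerSeries.X ^ w) * H ∧
      MvPolynomial.map (PowerSeries.constantCoeff (R := ℂ)) H = G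

/-- The coordinates of a pair (matrix, ternary form): the entries of the matrix and the
coefficients of the form. -/
noncomputable def pairCoords (A : Matrix (Fin 3) (Fin 3) ℂ) (G : MvPolynomial (Fin 3) ℂ) :
    (Fin 3 × Fin 3) ⊕ (Fin 3 →₀ ℕ) → ℂ :=
  Sum.elim (fun p => A p.1 p.2) (fun m => MvPolynomial.coeff m G)

/-- The proper transform `R` of the hypersurface of singular matrices in the blow-up of `ℙ⁸`
along the base scheme of the rational map `α ↦ F ∘ α`. The blow-up is the closure of the graph
of this map in `ℙ⁸ × ℙᴺ`, and `R` is the Zariski closure in `ℙ⁸ × ℙᴺ` of the part of the graph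
that lies over the singular matrices `B` with `F ∘ B ≠ 0`. A point of `ℙ⁸ × ℙᴺ` is given by
representatives `A ≠ 0`, `G ≠ 0`; the set of all representatives `(B, μ • (F ∘ B))` of points of
that part of the graph is stable under independent rescalings of the two components, so that its
vanishing ideal is generated by bihomogeneous polynomials. -/
def InSingularProperTransform (F : MvPolynomial (Fin 3) ℂ)
    (A : Matrix (Fin 3) (Fin 3) ℂ) (G : MvPolynomial (Fin 3) ℂ) : Prop :=
  A ≠ 0 ∧ G ≠ 0 ∧ ∀ P : MvPolynomial ((Fin 3 × Fin 3) ⊕ (Fin 3 →₀ ℕ)) ℂ,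
    (∀ (B : Matrix (Fin 3) (Fin 3) ℂ) (μ : ℂ), B.det = 0 → pullback F B ≠ 0 →
      MvPolynomial.eval (pairCoords B (μ • pullback F B)) P = 0) →
    MvPolynomial.eval (pairCoords A G) P = 0

/-- The curve `G = 0` is a rank-2 limit of the curve `F = 0`: it belongs to the image in `ℙᴺ` of
the intersection of `R` with the projective normal cone, that is, with the part of the blow-up
lying over the matrices `A` such that `F ∘ A` vanishes identically. -/
def IsRankTwoLimit (F G : MvPolynomial (Fin 3) ℂ) : Prop :=
  ∃ A : Matrix (Fin 3) (Fin 3) ℂ, pullback F A = 0 ∧ InSingularProperTransform F A G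

/-- Equivalence of germs: `β(t ν(t)) = α(t) ∘ m(t)` as germs in `ℙ⁸` (that is, up to a scalar unit
`κ(t)`), with `ν` a unit of `ℂ⟦t⟧` and `m(0) = I`. -/
def GermEquiv (α β : Matrix (Fin 3) (Fin 3) (PowerSeries ℂ)) : Prop :=
  ∃ (ν κ : PowerSeries ℂ) (m : Matrix (Fin 3) (Fin 3) (PowerSeries ℂ)),
    IsUnit ν ∧ IsUnit κ ∧ m.map (PowerSeries.constantCoeff (R := ℂ)) = 1 ∧
      κ • β.map (PowerSeries.subst (PowerSeries.X * ν)) = α * m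

/-! ### The standard form of a germ -/

/-- The lower triangular germ with rows `(1, 0, 0)`, `(q, t ^ b, 0)`, `(r, s t ^ b, t ^ c)`. -/
noncomputable def standardGerm (b c : ℕ) (q r s : ℂ[X]) :
    Matrix (Fin 3) (Fin 3) (PowerSeries ℂ) :=
  !![1, 0, 0;
     (q : PowerSeries ℂ), PowerSeries.X ^ b, 0;
     (r : PowerSeries ℂ), (s : PowerSeries ℂ) * PowerSeries.X ^ b, PowerSeries.X ^ c]

/-- The conditions on `b, c, q, r, s` in the standard form of a germ. The order of vanishing of
the zero polynomial is `+∞`, and its degree is `-∞`. -/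
structure IsStandardForm (b c : ℕ) (q r s : ℂ[X]) : Prop where
  one_le : 1 ≤ b
  le : b ≤ c
  degree_q : q.degree < (b : ℕ)
  degree_r : r.degree < (c : ℕ)
  degree_s : s.degree < ((c - b : ℕ) : WithBot ℕ)
  q_zero : q.eval 0 = 0
  r_zero : r.eval 0 = 0
  s_zero : s.eval 0 = 0
  order_lt : b = c → ¬ (q = 0 ∧ r = 0) →
    (q : PowerSeries ℂ).order < (r : PowerSeries ℂ).order

/-! ### Power series with fractional exponents, and formal branches -/

/-- The series in `y` with rational exponents which belong to `ℂ⟦y^(1/n)⟧` for some `n ≥ 1`. -/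
def IsPuiseux (f : HahnSeries ℚ ℂ) : Prop :=
  ∃ n : ℕ, 0 < n ∧ ∀ l ∈ f.support, ∃ k : ℕ, (n : ℚ) * l = k

/-- `z = f(y)` is a formal branch at `(1 : 0 : 0)` of the curve `F = 0`: the series `f` has
fractional exponents, all of them at least `1`, and `F(1, y, f(y)) = 0`, that is, `z - f(y)` is
a factor of `F(1, y, z)`. -/
def IsFormalBranch (F : MvPolynomial (Fin 3) ℂ) (f : HahnSeries ℚ ℂ) : Prop :=
  IsPuiseux f ∧ (∀ l ∈ f.support, 1 ≤ l) ∧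
    MvPolynomial.aeval ![1, HahnSeries.single (1 : ℚ) (1 : ℂ), f] F = 0

/-- The operator `y d/dy`: it sends `∑ γ_l y ^ l` to `∑ l γ_l y ^ l`. -/
noncomputable def eulerDeriv (f : HahnSeries ℚ ℂ) : HahnSeries ℚ ℂ where
  coeff l := (l : ℂ) * f.coeff l
  isPWO_support' := f.isPWO_support.mono fun l hl h => hl (by simp [h])

/-- The derivative `f'(y) = ∑ l γ_l y ^ (l - 1)` of `f(y) = ∑ γ_l y ^ l`. -/
noncomputable def fracDeriv (f : HahnSeries ℚ ℂ) : HahnSeries ℚ ℂ :=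
  HahnSeries.single (-1 : ℚ) (1 : ℂ) * eulerDeriv f

/-- The series `f(t ^ a) = ∑ γ_l t ^ (a l)`, for a positive integer `a`. -/
noncomputable def substPow (a : ℕ) (ha : 0 < a) (f : HahnSeries ℚ ℂ) : HahnSeries ℚ ℂ :=
  HahnSeries.embDomain
    (OrderEmbedding.ofStrictMono (fun l : ℚ => (a : ℚ) * l)
      (fun _ _ h => mul_lt_mul_of_pos_left h (Nat.cast_pos.mpr ha))) f

/-- The polynomial `p(t)` is the truncation modulo `t ^ c` of the series `g(t)` with fractional
exponents. In particular, all exponents smaller than `c` in `g` are nonnegative integers. -/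
def IsTruncation (c : ℕ) (g : HahnSeries ℚ ℂ) (p : ℂ[X]) : Prop :=
  HahnSeries.ofPowerSeries ℚ ℂ (p : PowerSeries ℂ) = HahnSeries.truncLT (c : ℚ) g

/-- The germ with rows `(1, 0, 0)`, `(t ^ a, t ^ b, 0)`, `(ρ, σ, t ^ c)`. -/
noncomputable def branchGerm (a b c : ℕ) (ρ σ : ℂ[X]) : Matrix (Fin 3) (Fin 3) (PowerSeries ℂ) :=
  !![1, 0, 0;
     PowerSeries.X ^ a, PowerSeries.X ^ b, 0;
     (ρ : PowerSeries ℂ), (σ : PowerSeries ℂ), PowerSeries.X ^ c]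

/-! ### Power series: completeness, roots of units, leading coefficients -/

namespace PowerSeries

/-! In the chart `x = 1` the germ sends `(y, z)` to `Y = q + t^b y`, `Z = r + s t^b y + t^c z`. By
Newton–Puiseux (`exists_puiseux_factorization`), after `y = X^N` the polynomial `F(1, y, z)` is a
product of factors `z - φ(X)` with `φ(0) = 0`, up to factors in `X` alone and factors `1 - w z`. Put
`t = X^N` and let `T` be an `N`-th root of `Y`. Taking lowest coefficients in `X` is multiplicative,
so up to constants and powers of the lowest coefficient of `T` the limit is the product of the
lowest coefficients of the series `Z - φ(T)` (`exists_branches`). Such a factor involves `z` exactly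
when `r + s t^b y - φ(T)` vanishes modulo `t^c`.

A limit free of `z`, or of `y`, is fixed by the singular matrix `diag(1,1,0)`, or `diag(1,0,1)`.
Composing the germ with this matrix gives an arc of singular matrices with the same limit, so the
limit is a rank-2 limit (`isRankTwoLimit_of_pullback_eq`). Hence both variables must occur. If `q =
0`, occurrence of `z` forces `r = s = 0` (`isRankTwoLimit_of_eq_zero`). If `q ≠ 0`, occurrence of
both forces `b < c` and a contact `r + s t^b y ≡ φ(T)` modulo `t^c` with some `φ ≠ 0`
(`exists_branch_of_not_isRankTwoLimit`).

Everything else is read off this congruence and its derivatives in `y`. Setting `y = 0` determines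
`r`; the first derivative at `y = 0` determines `s`, and `s(0) = 0` then makes the branch tangent to
`z = 0` (`contact_derivative`, `order_lt_of_contact`). The left side is linear in `y`, so the second
derivative of `φ(T)` vanishes modulo `t^c`; comparing orders yields the inequality
(`contact_inequality`). Finally, writing `q = (tν)^a` and reparametrizing by `tν` identifies `r` and
`s t^b` with truncations of the branch and of its derivative, and produces `M` (`exists_truncation`,
`exists_germEquiv_branchGerm`). -/

theorem smodEq_span_X_pow_iff {A : Type*} [CommRing A] (n : ℕ) (f g : A⟦X⟧) :
    f ≡ g [SMOD (Ideal.span {(X : A⟦X⟧)} ^ n • ⊤ : Submodule A⟦X⟧ A⟦X⟧)] ↔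
      ∀ i < n, coeff i f = coeff i g := by
  rw [SModEq.sub_mem, smul_eq_mul, Ideal.mul_top, Ideal.span_singleton_pow,
    Ideal.mem_span_singleton, X_pow_dvd_iff]
  simp [sub_eq_zero]

theorem isAdicComplete_span_X (A : Type*) [CommRing A] :
    IsAdicComplete (Ideal.span {(X : A⟦X⟧)}) A⟦X⟧ where
  haus' f hf := by
    ext n
    exact (smodEq_span_X_pow_iff (n + 1) f 0).1 (hf (n + 1)) n n.lt_succ_self
  prec' f hf := by
    refine ⟨mk fun n => coeff n (f (n + 1)), fun n => ?_⟩
    rw [smodEq_span_X_pow_iff]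
    intro i hi
    rw [coeff_mk]
    exact ((smodEq_span_X_pow_iff (i + 1) _ _).1 (hf hi) i i.lt_succ_self).symm

theorem mem_maximalIdeal_iff {k : Type*} [Field k] (f : k⟦X⟧) :
    f ∈ IsLocalRing.maximalIdeal k⟦X⟧ ↔ constantCoeff f = 0 := by
  rw [IsLocalRing.mem_maximalIdeal, mem_nonunits_iff, isUnit_iff_constantCoeff, isUnit_iff_ne_zero,
    not_not]

/-- Completeness is what makes Weierstrass preparation over `k⟦X⟧` available for the Newton–Puiseux
theorem. -/
instance isAdicComplete_maximalIdeal (k : Type*) [Field k] :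
    IsAdicComplete (IsLocalRing.maximalIdeal k⟦X⟧) k⟦X⟧ := by
  have h : IsLocalRing.maximalIdeal k⟦X⟧ = Ideal.span {(X : k⟦X⟧)} := by
    ext f
    rw [mem_maximalIdeal_iff, Ideal.mem_span_singleton, X_dvd_iff]
  rw [h]
  exact isAdicComplete_span_X k

section SubstHom

variable {k A : Type*} [CommRing k] [CommRing A] [Algebra k A]

/-- Substitution of a power series without constant term. -/
noncomputable def substHom (T : A⟦X⟧) (hT : constantCoeff T = 0) : k⟦X⟧ →ₐ[k] A⟦X⟧ :=
  substAlgHom (HasSubst.of_constantCoeff_zero' hT)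

theorem substHom_apply (T : A⟦X⟧) (hT : constantCoeff T = 0) (f : k⟦X⟧) :
    substHom T hT f = f.subst T := by
  rw [substHom, coe_substAlgHom]

@[simp]
theorem substHom_X (T : A⟦X⟧) (hT : constantCoeff T = 0) : substHom T hT (X : k⟦X⟧) = T := by
  rw [substHom_apply, subst_X (HasSubst.of_constantCoeff_zero' hT)]

@[simp]
theorem substHom_C (T : A⟦X⟧) (hT : constantCoeff T = 0) (a : k) :
    substHom T hT (C a) = C (algebraMap k A a) := by
  have h := (substHom (k := k) T hT).commutes a
  simpa [algebraMap_apply] using h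

@[simp]
theorem constantCoeff_substHom (T : A⟦X⟧) (hT : constantCoeff T = 0) (u : k⟦X⟧) :
    constantCoeff (substHom T hT u) = algebraMap k A (constantCoeff u) := by
  have h : constantCoeff (substHom T hT (u - C (constantCoeff u))) = 0 := by
    rw [substHom_apply]
    exact constantCoeff_subst_eq_zero hT _ (by simp)
  simpa [sub_eq_zero] using h

theorem X_pow_dvd_substHom (T : A⟦X⟧) (hT : constantCoeff T = 0) {n : ℕ} {f : k⟦X⟧}
    (h : X ^ n ∣ f) : X ^ n ∣ substHom T hT f := by
  have h1 := map_dvd (substHom T hT) h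
  rw [map_pow, substHom_X] at h1
  exact (pow_dvd_pow_of_dvd (X_dvd_iff.2 hT) n).trans h1

end SubstHom

theorem binomialSeries_inv_pow (N : ℕ) (hN : N ≠ 0) :
    (binomialSeries ℂ ((N : ℚ)⁻¹)) ^ N = 1 + X := by
  have h : ∀ n : ℕ, (binomialSeries ℂ ((N : ℚ)⁻¹)) ^ n = binomialSeries ℂ (n * (N : ℚ)⁻¹) := by
    intro n
    induction n with
    | zero => simp
    | succ n ih => rw [pow_succ, ih, ← binomialSeries_add]; congr 1; push_cast; ring
  rw [h, mul_inv_cancel₀ (by exact_mod_cast hN)]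
  simpa using binomialSeries_nat (R := ℚ) (A := ℂ) 1

/-- The root is the binomial series of exponent `1/N` evaluated at `w`, so coefficients in any
`ℂ`-algebra are allowed. -/
theorem exists_pow_eq_one_add {A : Type*} [CommRing A] [Algebra ℂ A] (N : ℕ) (hN : N ≠ 0)
    (w : A⟦X⟧) (hw : constantCoeff w = 0) :
    ∃ z : A⟦X⟧, constantCoeff z = 1 ∧ z ^ N = 1 + w :=
  ⟨substHom w hw (binomialSeries ℂ ((N : ℚ)⁻¹)), by simp, by
    rw [← map_pow, binomialSeries_inv_pow N hN, map_add, map_one, substHom_X]⟩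

theorem exists_pow_eq_of_isUnit (N : ℕ) (hN : N ≠ 0) (u : ℂ⟦X⟧) (hu : IsUnit u) :
    ∃ z : ℂ⟦X⟧, IsUnit z ∧ z ^ N = u := by
  have h0 : constantCoeff u ≠ 0 := ((isUnit_iff_constantCoeff).1 hu).ne_zero
  obtain ⟨k, hk⟩ := IsAlgClosed.exists_pow_nat_eq (constantCoeff u) (Nat.pos_of_ne_zero hN)
  obtain ⟨z, hz, hzN⟩ := exists_pow_eq_one_add N hN (C (constantCoeff u)⁻¹ * u - 1)
    (by simp [h0])
  have hz' : (C k * z) ^ N = u := by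
    rw [mul_pow, hzN, ← map_pow, hk, add_sub_cancel, ← mul_assoc, ← map_mul, mul_inv_cancel₀ h0,
      map_one, one_mul]
  refine ⟨C k * z, ?_, hz'⟩
  rw [← isUnit_pow_iff hN, hz']
  exact hu

section Lead

variable {A : Type*} [CommRing A] [IsDomain A]

/-- The leading (that is, lowest) coefficient of a power series. -/
noncomputable def lead : A⟦X⟧ →* A :=
  (constantCoeff (R := A) : A⟦X⟧ →* A).comp divXPowOrderHom

theorem lead_apply (f : A⟦X⟧) : lead f = coeff f.order.toNat f :=
  constantCoeff_divXPowOrder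

theorem lead_ne_zero {f : A⟦X⟧} (hf : f ≠ 0) : lead f ≠ 0 := by
  rw [lead_apply]
  exact coeff_order hf

omit [IsDomain A] in
theorem order_eq_of_coeff {f : A⟦X⟧} {n : ℕ} (h : ∀ i < n, coeff i f = 0) (hn : coeff n f ≠ 0) :
    f.order = n := order_eq_nat.2 ⟨hn, h⟩

theorem lead_eq_coeff {f : A⟦X⟧} {n : ℕ} (h : ∀ i < n, coeff i f = 0) (hn : coeff n f ≠ 0) :
    lead f = coeff n f := by
  rw [lead_apply, order_eq_of_coeff h hn, ENat.toNat_natCast]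

theorem lead_eq_constantCoeff {f : A⟦X⟧} (h : constantCoeff f ≠ 0) :
    lead f = constantCoeff f := by
  rw [lead_eq_coeff (n := 0) (by simp) (by simpa using h), coeff_zero_eq_constantCoeff_apply]

theorem lead_X_pow_mul (n : ℕ) {f : A⟦X⟧} (h : constantCoeff f ≠ 0) :
    lead (X ^ n * f) = constantCoeff f := by
  have h' : lead ((X : A⟦X⟧) ^ n) = 1 := by
    rw [lead_eq_coeff (n := n)]
    · simp
    · intro i hi
      rw [coeff_X_pow, if_neg hi.ne]
    · simp
  rw [map_mul, h', one_mul, lead_eq_constantCoeff h]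

theorem exists_eq_X_pow_mul {f : A⟦X⟧} (hf : f ≠ 0) :
    ∃ (n : ℕ) (u : A⟦X⟧), f = X ^ n * u ∧ constantCoeff u ≠ 0 ∧ f.order = n ∧
      lead f = constantCoeff u :=
  ⟨f.order.toNat, divXPowOrder f, X_pow_order_mul_divXPowOrder.symm,
    constantCoeff_divXPowOrder_eq_zero_iff.not.2 hf, (coe_toNat_order hf).symm, rfl⟩

variable {k : Type*} [Field k] [Algebra k A]

theorem substHom_ne_zero_and_lead {T : A⟦X⟧} (hT0 : T ≠ 0) (hT : constantCoeff T = 0)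
    {f : k⟦X⟧} (hf : f ≠ 0) :
    substHom T hT f ≠ 0 ∧
      (substHom T hT f).order = f.order.toNat * T.order ∧
      lead (substHom T hT f) = algebraMap k A (lead f) * lead T ^ f.order.toNat := by
  obtain ⟨n, u, hfu, hu, hn, hl⟩ := exists_eq_X_pow_mul hf
  have hn' : f.order.toNat = n := by rw [hn]; rfl
  have hu' : constantCoeff (substHom T hT u) ≠ 0 := by
    rw [constantCoeff_substHom]
    exact (map_ne_zero _).2 hu
  have e : substHom T hT f = T ^ n * substHom T hT u := by
    conv_lhs => rw [hfu]
    rw [map_mul, map_pow, substHom_X]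
  have hu0 : substHom T hT u ≠ 0 := fun h => hu' (by rw [h, map_zero])
  refine ⟨?_, ?_, ?_⟩
  · rw [e]
    exact mul_ne_zero (pow_ne_zero _ hT0) hu0
  · have : (substHom T hT u).order = 0 :=
      order_eq_of_coeff (n := 0) (by simp) (by simpa using hu')
    rw [e, order_mul, order_pow, hn', this, add_zero, nsmul_eq_mul]
  · rw [e, map_mul, map_pow, hn', lead_eq_constantCoeff hu', constantCoeff_substHom, hl, mul_comm]

end Lead

end PowerSeries

/-! ### The Newton–Puiseux theorem -/

namespace PowerSeries

variable {k : Type*} [Field k]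

/-- The substitution of `X ^ N` for `X`, as a ring homomorphism. -/
noncomputable def expandHom (N : ℕ) (hN : N ≠ 0) : k⟦X⟧ →+* k⟦X⟧ :=
  (expand N hN : k⟦X⟧ →ₐ[k] k⟦X⟧).toRingHom

@[simp]
theorem expandHom_apply (N : ℕ) (hN : N ≠ 0) (f : k⟦X⟧) : expandHom N hN f = expand N hN f := rfl

/-- Weierstrass preparation gives a distinguished polynomial times a unit power series. When `P` is
a polynomial the unit is one too: Euclidean division by `W` is also a Weierstrass division, and
uniqueness identifies the quotients and kills the remainder. -/
theorem exists_weierstrass_factor (P : k⟦X⟧[X]) (hP : P.map (constantCoeff (R := k)) ≠ 0) :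
    ∃ W Q : k⟦X⟧[X], W.Monic ∧ P = W * Q ∧ (∀ i < W.natDegree, constantCoeff (W.coeff i) = 0) ∧
      constantCoeff (Q.coeff 0) ≠ 0 := by
  have hP' : (P : k⟦X⟧⟦X⟧).map (IsLocalRing.residue k⟦X⟧) ≠ 0 := by
    contrapose! hP
    ext i
    have h := congrArg (coeff i) hP
    rw [coeff_map, Polynomial.coeff_coe, map_zero, IsLocalRing.residue_eq_zero_iff,
      mem_maximalIdeal_iff] at h
    simpa using h
  obtain ⟨W, h, H⟩ := exists_isWeierstrassFactorization hP'
  have hW := H.isDistinguishedAt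
  have hmod := Polynomial.modByMonic_add_div P W
  have hdiv := hW.isWeierstrassDivisorAt'
  have hdeg : W.natDegree = _ := congr(ENat.toNat $(hW.coe_natDegree_eq_order_map W 1
    (by rw [constantCoeff_one, ← Ideal.ne_top_iff_one]; exact Ideal.IsPrime.ne_top') (by simp)))
  have hlt : (P %ₘ W).degree < W.natDegree := by
    rw [← Polynomial.degree_eq_natDegree hW.monic.ne_zero]
    exact Polynomial.degree_modByMonic_lt _ hW.monic
  obtain ⟨h1, h2⟩ := hdiv.eq_of_mul_add_eq_mul_add (q := (P /ₘ W : k⟦X⟧[X])) (q' := h)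
    (r := P %ₘ W) (r' := 0) (by rwa [← hdeg]) (by rw [Polynomial.degree_zero]; exact WithBot.bot_lt_coe _)
    (by rw [Polynomial.coe_zero, add_zero, ← H.eq_mul, ← Polynomial.coe_mul, ← Polynomial.coe_add,
      add_comm, hmod])
  rw [h2, zero_add] at hmod
  refine ⟨W, P /ₘ W, hW.monic, hmod.symm, fun i hi => (mem_maximalIdeal_iff _).1 (hW.mem hi), ?_⟩
  have hu := H.isUnit
  rw [← h1, isUnit_iff_constantCoeff, isUnit_iff_constantCoeff] at hu
  simpa using hu.ne_zero

theorem coeff_taylor_natDegree_sub_one {R : Type*} [CommRing R] (P : R[X]) (hP : P.Monic) (n : ℕ)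
    (hn : P.natDegree = n + 1) (r : R) :
    (P.taylor r).coeff n = P.coeff n + (n + 1) * r := by
  have hd : (Polynomial.hasseDeriv n P).natDegree ≤ 1 :=
    (Polynomial.natDegree_hasseDeriv_le P n).trans (by omega)
  have hl : P.coeff (n + 1) = 1 := by rw [← hn]; exact hP
  rw [Polynomial.taylor_coeff, Polynomial.eq_X_add_C_of_natDegree_le_one hd,
    Polynomial.hasseDeriv_coeff, Polynomial.hasseDeriv_coeff]
  simp [add_comm 1 n, hl, add_comm]

/-- This is the first Newton polygon step. With least slope `p/m`, the substitutions `X ↦ X^m` and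
`z ↦ X^p z` leave integral coefficients, one of which, below the top degree, becomes a unit. -/
theorem exists_root_of_depressed (P : k⟦X⟧[X]) (n : ℕ) (hP : P.Monic) (hn : P.natDegree = n + 1)
    (h0 : P.coeff n = 0) (hne : P ≠ Polynomial.X ^ (n + 1)) :
    ∃ (m : ℕ) (hm : m ≠ 0) (p : ℕ) (Q : k⟦X⟧[X]), Q.Monic ∧ Q.natDegree = n + 1 ∧ Q.coeff n = 0 ∧
      P.map (expandHom m hm) = Q.scaleRoots (X ^ p) ∧
      Q.map (constantCoeff (R := k)) ≠ Polynomial.X ^ (n + 1) := by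
  classical
  have hlead : P.coeff (n + 1) = 1 := by rw [← hn]; exact hP
  have hI : ((Finset.range (n + 1)).filter fun i => P.coeff i ≠ 0).Nonempty := by
    by_contra hI
    rw [Finset.not_nonempty_iff_eq_empty, Finset.filter_eq_empty_iff] at hI
    apply hne
    ext1 i
    rw [Polynomial.coeff_X_pow]
    rcases lt_trichotomy i (n + 1) with hi | hi | hi
    · rw [if_neg hi.ne]
      simpa using hI (Finset.mem_range.2 hi)
    · rw [if_pos hi, hi, hlead]
    · rw [if_neg hi.ne', Polynomial.coeff_eq_zero_of_natDegree_lt (by omega)]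
  -- The index `j` realizes the least slope `ord(P_i) / (n + 1 - i)`, so `m = n + 1 - j` is a
  -- denominator for it.
  obtain ⟨j, hj, hmin⟩ := Finset.exists_min_image _
    (fun i => ((P.coeff i).order.toNat : ℚ) / ((n + 1 - i : ℕ) : ℚ)) hI
  rw [Finset.mem_filter, Finset.mem_range] at hj
  obtain ⟨hjn, hj0⟩ := hj
  have hm : n + 1 - j ≠ 0 := by omega
  set m := n + 1 - j with hmdef
  set p := (P.coeff j).order.toNat with hp
  have hle : ∀ i ≤ n, P.coeff i ≠ 0 → p * (n + 1 - i) ≤ m * (P.coeff i).order.toNat := by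
    intro i hi hi0
    have h := hmin i (Finset.mem_filter.2 ⟨Finset.mem_range.2 (by omega), hi0⟩)
    have h1 : 0 < n + 1 - i := by omega
    have h2 : 0 < m := by omega
    rw [div_le_div_iff₀ (by exact_mod_cast h2) (by exact_mod_cast h1), mul_comm _ (m : ℚ)] at h
    exact_mod_cast h
  have hb : ∀ i, ∃ b : k⟦X⟧, expand m hm (P.coeff i) = X ^ (p * (n + 1 - i)) * b ∧
      (P.coeff i = 0 → b = 0) := by
    intro i
    by_cases hi0 : P.coeff i = 0
    · exact ⟨0, by simp [hi0], fun _ => rfl⟩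
    by_cases hi : i ≤ n
    · have h : (X : k⟦X⟧) ^ (p * (n + 1 - i)) ∣ expand m hm (P.coeff i) := by
        rw [X_pow_dvd_iff]
        intro l hl
        apply coeff_of_lt_order
        rw [order_expand, ← coe_toNat_order hi0, nsmul_eq_mul]
        exact_mod_cast hl.trans_le (hle i hi hi0)
      obtain ⟨b, hb⟩ := h
      exact ⟨b, hb, fun h => absurd h hi0⟩
    · have : n + 1 - i = 0 := by omega
      exact ⟨expand m hm (P.coeff i), by simp [this], fun h => absurd h hi0⟩
  choose b hb hb0 using hb
  set S : k⟦X⟧[X] := ∑ i ∈ Finset.range (n + 1), Polynomial.monomial i (b i) with hS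
  have hSc : ∀ i, S.coeff i = if i < n + 1 then b i else 0 := by
    intro i
    simp [hS, Polynomial.finsetSum_coeff, Polynomial.coeff_monomial]
  have hSd : S.degree < ((n + 1 : ℕ) : WithBot ℕ) := by
    rw [Polynomial.degree_lt_iff_coeff_zero]
    intro i hi
    rw [hSc, if_neg (by omega)]
  have hQm : (Polynomial.X ^ (n + 1) + S).Monic := Polynomial.monic_X_pow_add hSd
  have hQd : (Polynomial.X ^ (n + 1) + S).natDegree = n + 1 :=
    Polynomial.natDegree_eq_of_degree_eq_some (by
      rw [Polynomial.degree_add_eq_left_of_degree_lt (by rwa [Polynomial.degree_X_pow]),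
        Polynomial.degree_X_pow])
  refine ⟨m, hm, p, Polynomial.X ^ (n + 1) + S, hQm, hQd, ?_, ?_, ?_⟩
  · rw [Polynomial.coeff_add, hSc, if_pos (by omega), Polynomial.coeff_X_pow, if_neg (by omega),
      hb0 n h0, zero_add]
  · ext1 i
    rw [Polynomial.coeff_map, Polynomial.coeff_scaleRoots, hQd, Polynomial.coeff_add, hSc,
      Polynomial.coeff_X_pow, expandHom_apply]
    rcases lt_trichotomy i (n + 1) with hi | hi | hi
    · rw [if_neg hi.ne, if_pos hi, hb, zero_add, ← pow_mul, mul_comm]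
    · rw [hi, hlead]; simp
    · rw [if_neg hi.ne', if_neg (by omega), Polynomial.coeff_eq_zero_of_natDegree_lt (by omega)]
      simp
  -- The `j`-th coefficient has order exactly `p * m` after ramification, so nothing of positive
  -- order remains after dividing by `X^(p * m)`.
  · intro h
    have h1 := congrArg (fun q => Polynomial.coeff q j) h
    simp only [Polynomial.coeff_map, Polynomial.coeff_add, hSc, Polynomial.coeff_X_pow,
      if_pos hjn, if_neg hjn.ne, zero_add] at h1
    have h2 := hb j
    have h3 : (expand m hm (P.coeff j)).order = ((p * m : ℕ) : ℕ∞) := by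
      rw [order_expand, ← coe_toNat_order hj0, ← hp, nsmul_eq_mul, mul_comm p]
      push_cast
      rfl
    have h4 := (order_eq_nat.1 h3).1
    rw [h2, ← hmdef, coeff_X_pow_mul', if_pos le_rfl, Nat.sub_self,
      coeff_zero_eq_constantCoeff_apply] at h4
    exact h4 h1

/-- Induction on the degree. After removing the subleading coefficient and rescaling along the
Newton slope, the reduction has sum of roots zero but is not a pure power, so no root has full
multiplicity. Weierstrass preparation at one root then splits off a factor of smaller positive
degree. -/
theorem exists_root_expand_of_monic [IsAlgClosed k] [CharZero k] (d : ℕ) :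
    ∀ P : k⟦X⟧[X], P.Monic → P.natDegree = d → d ≠ 0 →
      ∃ (N : ℕ) (hN : N ≠ 0) (h : k⟦X⟧), (P.map (expandHom N hN)).eval h = 0 := by
  induction d using Nat.strong_induction_on with
  | _ d ih =>
  intro P hP hd hd0
  obtain ⟨n, rfl⟩ := Nat.exists_eq_succ_of_ne_zero hd0
  have hn0 : ((n + 1 : ℕ) : k) ≠ 0 := Nat.cast_ne_zero.2 hd0
  -- The Tschirnhaus shift, which kills the coefficient of degree `n`; this needs characteristic
  -- zero.
  set r : k⟦X⟧ := - C (((n + 1 : ℕ) : k)⁻¹) * P.coeff n with hr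
  have hcast : ((n : k⟦X⟧) + 1) = C ((n + 1 : ℕ) : k) := by simp
  have hP1c : (P.taylor r).coeff n = 0 := by
    rw [coeff_taylor_natDegree_sub_one P hP n hd, hr, hcast, neg_mul, mul_neg, ← mul_assoc,
      ← map_mul, mul_inv_cancel₀ hn0]
    simp
  have hP1m : (P.taylor r).Monic := by
    rw [Polynomial.Monic, Polynomial.leadingCoeff_taylor]; exact hP
  have hP1d : (P.taylor r).natDegree = n + 1 := by rw [Polynomial.natDegree_taylor, hd]
  suffices hs : ∃ (N : ℕ) (hN : N ≠ 0) (h : k⟦X⟧),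
      ((P.taylor r).map (expandHom N hN)).eval h = 0 by
    obtain ⟨N, hN, h, hh⟩ := hs
    rw [Polynomial.map_taylor, Polynomial.taylor_eval] at hh
    exact ⟨N, hN, _, hh⟩
  by_cases hX : P.taylor r = Polynomial.X ^ (n + 1)
  · exact ⟨1, one_ne_zero, 0, by rw [hX]; simp⟩
  obtain ⟨m, hm, p, Q, hQ, hQd, hQc, hPQ, hQX⟩ := exists_root_of_depressed _ n hP1m hP1d hP1c hX
  suffices hs : ∃ (N : ℕ) (hN : N ≠ 0) (h : k⟦X⟧),
      (Q.map (expandHom N hN)).eval h = 0 by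
    obtain ⟨N, hN, h, hh⟩ := hs
    refine ⟨N * m, mul_ne_zero hN hm, expand N hN (X ^ p) * h, ?_⟩
    have hc : expandHom (k := k) (N * m) (mul_ne_zero hN hm) =
        (expandHom N hN).comp (expandHom m hm) := by
      ext f : 1
      exact expand_mul N hN m hm f
    rw [hc, ← Polynomial.map_map, hPQ, Polynomial.eval_map]
    rw [Polynomial.eval_map] at hh
    exact Polynomial.scaleRoots_eval₂_eq_zero _ hh
  set q := Q.map (constantCoeff (R := k)) with hq
  have hqm : q.Monic := hQ.map _
  have hqd : q.natDegree = n + 1 := by rw [hq, hQ.natDegree_map, hQd]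
  obtain ⟨ρ, hρ⟩ := IsAlgClosed.exists_root q (by
    rw [Polynomial.degree_eq_natDegree hqm.ne_zero, hqd]; exact_mod_cast hd0)
  have hres : (Q.taylor (C ρ)).map (constantCoeff (R := k)) = q.taylor ρ := by
    rw [Polynomial.map_taylor, constantCoeff_C]
  obtain ⟨W, S, hW, hWS, hWc, hS⟩ := exists_weierstrass_factor (Q.taylor (C ρ)) (by
    rw [hres, Ne, Polynomial.taylor_eq_zero]; exact hqm.ne_zero)
  have hQ3m : (Q.taylor (C ρ)).Monic := by
    rw [Polynomial.Monic, Polynomial.leadingCoeff_taylor]; exact hQ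
  have hQ3d : (Q.taylor (C ρ)).natDegree = n + 1 := by rw [Polynomial.natDegree_taylor, hQd]
  have hSm : S.Monic := hW.of_mul_monic_left (by rw [← hWS]; exact hQ3m)
  have hdeg : W.natDegree + S.natDegree = n + 1 := by
    rw [← hW.natDegree_mul hSm, ← hWS, hQ3d]
  have hW0 : W.natDegree ≠ 0 := by
    intro h0
    have hW1 : W = 1 := hW.natDegree_eq_zero.1 h0
    apply hS
    have h1 : (q.taylor ρ).coeff 0 = 0 := by rw [Polynomial.taylor_coeff_zero]; exact hρ
    rw [← hres, hWS, hW1, one_mul, Polynomial.coeff_map] at h1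
    exact h1
  -- Full degree would make the reduction `(z - ρ)^(n+1)`. Its vanishing subleading coefficient
  -- forces `ρ = 0`, contrary to `hQX`.
  have hWn : W.natDegree ≠ n + 1 := by
    intro h0
    have hS1 : S = 1 := hSm.natDegree_eq_zero.1 (by omega)
    rw [hS1, mul_one] at hWS
    have h1 : q.taylor ρ = Polynomial.X ^ (n + 1) := by
      rw [← hres, hWS]
      ext i
      rw [Polynomial.coeff_map, Polynomial.coeff_X_pow]
      rcases lt_trichotomy i (n + 1) with hi | hi | hi
      · rw [hWc i (by omega), if_neg hi.ne]
      · rw [if_pos hi, hi, ← h0, hW.coeff_natDegree, map_one]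
      · rw [if_neg hi.ne', Polynomial.coeff_eq_zero_of_natDegree_lt (by omega), map_zero]
    have h2 := coeff_taylor_natDegree_sub_one q hqm n hqd ρ
    have h3 : q.coeff n = 0 := by rw [hq, Polynomial.coeff_map, hQc, map_zero]
    rw [h1, h3, Polynomial.coeff_X_pow, if_neg (by omega), zero_add, eq_comm, mul_eq_zero] at h2
    have h4 : ρ = 0 := h2.resolve_left (by exact_mod_cast hn0)
    rw [h4, Polynomial.taylor_zero] at h1
    exact hQX h1
  obtain ⟨N, hN, h, hh⟩ := ih W.natDegree (by omega) W hW rfl hW0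
  refine ⟨N, hN, h + C ρ, ?_⟩
  have h1 : ((Q.taylor (C ρ)).map (expandHom N hN)).eval h = 0 := by
    rw [hWS, Polynomial.map_mul, Polynomial.eval_mul, hh, zero_mul]
  rw [Polynomial.map_taylor, Polynomial.taylor_eval] at h1
  simpa [expand_C] using h1

/-- A linear factor `a z - b` is either `a (z - φ)` with `φ(0) = 0` or `-b (1 - w z)`. The second
kind is a nonzero series in `X` times something equal to `1` at `z = 0`. -/
theorem linear_factor_cases (a b : k⟦X⟧) :
    (∃ φ : k⟦X⟧, constantCoeff φ = 0 ∧ b = a * φ) ∨ (b ≠ 0 ∧ ∃ w, a = b * w) := by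
  by_cases hb : b = 0
  · exact Or.inl ⟨0, map_zero _, by simp [hb]⟩
  rcases ValuationRing.dvd_total a b with ⟨φ, h⟩ | ⟨w, h⟩
  · by_cases hφ : constantCoeff φ = 0
    · exact Or.inl ⟨φ, hφ, h⟩
    · obtain ⟨u, hu⟩ := isUnit_iff_constantCoeff.2 (isUnit_iff_ne_zero.2 hφ)
      refine Or.inr ⟨hb, (u⁻¹ : (k⟦X⟧)ˣ), ?_⟩
      rw [h, ← hu, mul_assoc, Units.mul_inv, mul_one]
  · exact Or.inr ⟨hb, w, h⟩

/-- Up to factors that do not vanish at `X = 0`, `Z = 0` for `X ≠ 0`, a polynomial in `Z` over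
`k⟦X⟧` is a product of factors `Z - φ(X ^ (1 / N))`, where the series `φ` have no constant term. -/
theorem exists_puiseux_factorization [IsAlgClosed k] [CharZero k] (n : ℕ) :
    ∀ P : k⟦X⟧[X], P ≠ 0 → P.natDegree = n →
    ∃ (N : ℕ) (hN : N ≠ 0) (U v : k⟦X⟧) (ws φs : Multiset k⟦X⟧), U ≠ 0 ∧ v ≠ 0 ∧
      (∀ φ ∈ φs, constantCoeff φ = 0) ∧
      Polynomial.C U * P.map (expandHom N hN) =
        Polynomial.C v * (ws.map fun w => 1 - Polynomial.C w * Polynomial.X).prod *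
          (φs.map fun φ => Polynomial.X - Polynomial.C φ).prod := by
  induction n with
  | zero =>
    intro P hP hn
    rw [Polynomial.eq_C_of_natDegree_eq_zero hn] at hP ⊢
    refine ⟨1, one_ne_zero, 1, P.coeff 0, 0, 0, one_ne_zero, fun h => hP (by rw [h, map_zero]),
      by simp, ?_⟩
    simp
  | succ n ih =>
    intro P hP hn
    set u := P.leadingCoeff with hu
    have hu0 : u ≠ 0 := Polynomial.leadingCoeff_ne_zero.2 hP
    obtain ⟨N, hN, h, hh⟩ := exists_root_expand_of_monic (n + 1) P.integralNormalization
      (Polynomial.monic_integralNormalization hP) (by rw [Polynomial.natDegree_integralNormalization, hn])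
      n.succ_ne_zero
    have hinj : ∀ (M : ℕ) (hM : M ≠ 0), Function.Injective (expandHom (k := k) M hM) := by
      intro M hM
      rw [injective_iff_map_eq_zero]
      intro f hf
      ext i
      rw [← coeff_expand_mul M hM f i, ← expandHom_apply, hf]
      simp
    set e := expandHom (k := k) N hN with he
    obtain ⟨S, hS⟩ := Polynomial.dvd_iff_isRoot.2 hh
    have heu : e u ≠ 0 := fun h0 => hu0 (hinj N hN (by rw [h0, map_zero]))
    -- With `u` the leading coefficient, `u^n P(z)` is the monic normalization evaluated at `u z`;
    -- its root `h` thus becomes the linear factor `u z - h`.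
    have key : Polynomial.C (e u ^ n) * P.map e =
        (Polynomial.C (e u) * Polynomial.X - Polynomial.C h) *
          S.comp (Polynomial.C (e u) * Polynomial.X) := by
      have h1 := Polynomial.integralNormalization_eval₂_leadingCoeff_mul (p := P) (by omega)
        (Polynomial.C.comp e) Polynomial.X
      rw [hn, Nat.add_sub_cancel] at h1
      have h2 : Polynomial.eval₂ (Polynomial.C.comp e) Polynomial.X P = P.map e := rfl
      rw [h2] at h1
      rw [map_pow]
      refine h1.symm.trans ?_
      rw [← Polynomial.eval₂_map, hS, Polynomial.eval₂_mul, Polynomial.comp]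
      simp [hu]
    have hPe : P.map e ≠ 0 := by
      rwa [Ne, Polynomial.map_eq_zero_iff (hinj N hN)]
    set S' := S.comp (Polynomial.C (e u) * Polynomial.X) with hS'
    have hL : Polynomial.C (e u ^ n) * P.map e ≠ 0 :=
      mul_ne_zero (Polynomial.C_ne_zero.2 (pow_ne_zero _ heu)) hPe
    have hS0 : S' ≠ 0 := by
      intro h0
      rw [key, h0, mul_zero] at hL
      exact hL rfl
    have hl0 : Polynomial.C (e u) * Polynomial.X - Polynomial.C h ≠ 0 := by
      intro h0
      rw [key, h0, zero_mul] at hL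
      exact hL rfl
    have hld : (Polynomial.C (e u) * Polynomial.X - Polynomial.C h).natDegree = 1 := by
      rw [sub_eq_add_neg, ← Polynomial.C_neg]
      exact Polynomial.natDegree_linear heu
    have hSd : S'.natDegree = n := by
      have h1 := congrArg Polynomial.natDegree key
      rw [Polynomial.natDegree_C_mul (pow_ne_zero _ heu),
        Polynomial.natDegree_map_eq_of_injective (hinj N hN), hn,
        Polynomial.natDegree_mul hl0 hS0, hld] at h1
      omega
    obtain ⟨N', hN', U, v, ws, φs, hU, hv, hφ, hprod⟩ := ih S' hS0 hSd
    set e' := expandHom (k := k) N' hN' with he'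
    have hc : expandHom (k := k) (N' * N) (mul_ne_zero hN' hN) = e'.comp e := by
      ext f : 1
      exact expand_mul N' hN' N hN f
    have key' : Polynomial.C (U * e' (e u ^ n)) *
        P.map (expandHom (N' * N) (mul_ne_zero hN' hN)) =
        (Polynomial.C (e' (e u)) * Polynomial.X - Polynomial.C (e' h)) *
          (Polynomial.C v * (ws.map fun w => 1 - Polynomial.C w * Polynomial.X).prod *
          (φs.map fun φ => Polynomial.X - Polynomial.C φ).prod) := by
      rw [← hprod, hc, ← Polynomial.map_map]
      have h1 := congrArg (Polynomial.map e') key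
      simp only [Polynomial.map_mul, Polynomial.map_sub, Polynomial.map_C, Polynomial.map_X] at h1
      rw [map_mul, mul_assoc, h1]
      ring
    have heu' : e' (e u) ≠ 0 := fun h0 => heu (hinj N' hN' (by rw [h0, map_zero]))
    have hU' : U * e' (e u ^ n) ≠ 0 := by
      rw [map_pow]
      exact mul_ne_zero hU (pow_ne_zero _ heu')
    rcases linear_factor_cases (e' (e u)) (e' h) with ⟨φ, hφ0, hφe⟩ | ⟨hb, w, hw⟩
    · refine ⟨N' * N, mul_ne_zero hN' hN, _, e' (e u) * v, ws, φ ::ₘ φs, hU',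
        mul_ne_zero heu' hv, ?_, ?_⟩
      · intro ψ hψ
        rcases Multiset.mem_cons.1 hψ with rfl | hψ
        · exact hφ0
        · exact hφ ψ hψ
      · rw [key', hφe, Multiset.map_cons, Multiset.prod_cons, map_mul, map_mul]
        ring
    · refine ⟨N' * N, mul_ne_zero hN' hN, _, - e' h * v, w ::ₘ ws, φs, hU',
        mul_ne_zero (neg_ne_zero.2 hb) hv, hφ, ?_⟩
      rw [key', hw, Multiset.map_cons, Multiset.prod_cons, map_mul, map_mul, map_neg]
      ring

end PowerSeries

/-! ### Limits that are rank-2 limits -/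

/-! ### Composition with matrices and base change. -/

section Pullback

variable {R S : Type*} [CommRing R] [Algebra ℂ R] [CommRing S] [Algebra ℂ S]

theorem map_pullback (f : R →ₐ[ℂ] S) (F : MvPolynomial (Fin 3) ℂ) (α : Matrix (Fin 3) (Fin 3) R) :
    MvPolynomial.map (f : R →+* S) (pullback F α) = pullback F (α.map f) := by
  have h : (MvPolynomial.mapAlgHom f).comp
      (MvPolynomial.aeval (fun i => ∑ j, MvPolynomial.C (α i j) * MvPolynomial.X j)) =
      (MvPolynomial.aeval (fun i => ∑ j, MvPolynomial.C ((α.map f) i j) * MvPolynomial.X j) :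
        MvPolynomial (Fin 3) ℂ →ₐ[ℂ] MvPolynomial (Fin 3) S) := by
    ext1 i
    simp
  exact DFunLike.congr_fun h F

/-- The linear change of variables `X i ↦ ∑ j, N i j * X j`. -/
noncomputable def linSubst (N : Matrix (Fin 3) (Fin 3) R) :
    MvPolynomial (Fin 3) R →ₐ[R] MvPolynomial (Fin 3) R :=
  MvPolynomial.aeval fun i => ∑ j, MvPolynomial.C (N i j) * MvPolynomial.X j

theorem pullback_mul (F : MvPolynomial (Fin 3) ℂ) (α N : Matrix (Fin 3) (Fin 3) R) :
    pullback F (α * N) = linSubst N (pullback F α) := by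
  have h : ((linSubst N).restrictScalars ℂ).comp
      (MvPolynomial.aeval (fun i => ∑ j, MvPolynomial.C (α i j) * MvPolynomial.X j)) =
      (MvPolynomial.aeval (fun i => ∑ j, MvPolynomial.C ((α * N) i j) * MvPolynomial.X j) :
        MvPolynomial (Fin 3) ℂ →ₐ[ℂ] MvPolynomial (Fin 3) R) := by
    ext1 i
    simp only [AlgHom.comp_apply, MvPolynomial.aeval_X, AlgHom.coe_restrictScalars', map_sum,
      map_mul, linSubst, Matrix.mul_apply, Finset.sum_mul, MvPolynomial.algHom_C,
      MvPolynomial.algebraMap_eq, Finset.mul_sum]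
    rw [Finset.sum_comm]
    simp only [mul_assoc]
  exact (DFunLike.congr_fun h F).symm

omit [Algebra ℂ R] [Algebra ℂ S] in
theorem map_linSubst (f : R →+* S) (N : Matrix (Fin 3) (Fin 3) R) (H : MvPolynomial (Fin 3) R) :
    MvPolynomial.map f (linSubst N H) = linSubst (N.map f) (MvPolynomial.map f H) := by
  induction H using MvPolynomial.induction_on with
  | C a => simp [linSubst, MvPolynomial.algHom_C]
  | add p q hp hq => simp only [map_add, hp, hq]
  | mul_X p i hp => simp only [map_mul, hp, MvPolynomial.map_X]; simp [linSubst]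

theorem linSubst_eq_pullback (N : Matrix (Fin 3) (Fin 3) ℂ) (G : MvPolynomial (Fin 3) ℂ) :
    linSubst N G = pullback G N := rfl

end Pullback

/-- The germ `standardGerm` with polynomial entries. -/
noncomputable def standardPoly (b c : ℕ) (q r s : ℂ[X]) : Matrix (Fin 3) (Fin 3) ℂ[X] :=
  !![1, 0, 0; q, Polynomial.X ^ b, 0; r, s * Polynomial.X ^ b, Polynomial.X ^ c]

theorem standardPoly_map_coe (b c : ℕ) (q r s : ℂ[X]) :
    (standardPoly b c q r s).map (Polynomial.coeToPowerSeries.algHom (R := ℂ) ℂ) =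
      standardGerm b c q r s := by
  ext i j : 1
  fin_cases i <;> fin_cases j <;> simp [standardPoly, standardGerm]

theorem standardPoly_map_eval_zero {b c : ℕ} {q r s : ℂ[X]} (h : IsStandardForm b c q r s) :
    (standardPoly b c q r s).map (Polynomial.aeval (0 : ℂ)) = !![1, 0, 0; 0, 0, 0; 0, 0, 0] := by
  have h1 := h.q_zero
  have h2 := h.r_zero
  have h3 := h.s_zero
  have h4 := h.one_le
  have h5 := h.le
  have hb : b ≠ 0 := by omega
  have hc : c ≠ 0 := by omega
  ext i j : 1
  fin_cases i <;> fin_cases j <;>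
    simp [standardPoly, Polynomial.coe_aeval_eq_eval, h1, h2, hb, hc]

theorem MvPolynomial.IsHomogeneous.sum_eq {F : MvPolynomial (Fin 3) ℂ} {d : ℕ}
    (hFd : F.IsHomogeneous d) {m : Fin 3 →₀ ℕ} (hm : MvPolynomial.coeff m F ≠ 0) :
    m 0 + m 1 + m 2 = d := by
  have h : Finsupp.weight (fun _ => 1) m = d := hFd hm
  rw [← Finsupp.degree_eq_weight_one, Finsupp.degree_eq_sum, Fin.sum_univ_three] at h
  exact h

theorem MvPolynomial.IsHomogeneous.aeval_mul {R : Type*} [CommRing R] [Algebra ℂ R]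
    {F : MvPolynomial (Fin 3) ℂ} {d : ℕ} (hFd : F.IsHomogeneous d) (x : R) (g : Fin 3 → R) :
    MvPolynomial.aeval (fun i => x * g i) F = x ^ d * MvPolynomial.aeval g F := by
  rw [MvPolynomial.aeval_def, MvPolynomial.aeval_def, MvPolynomial.eval₂_eq',
    MvPolynomial.eval₂_eq', Finset.mul_sum]
  refine Finset.sum_congr rfl fun m hm => ?_
  rw [← hFd.sum_eq (MvPolynomial.mem_support_iff.1 hm)]
  simp only [Fin.prod_univ_three, mul_pow, pow_add]
  ring

/-- The image of the corner matrix is the point `p`, so `F` of it is `x^d F(p) = 0`, up to a linear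
substitution. -/
theorem pullback_cornerMatrix_mul {F : MvPolynomial (Fin 3) ℂ} {d : ℕ} (hFd : F.IsHomogeneous d)
    (hp : MvPolynomial.eval ![1, 0, 0] F = 0) (N : Matrix (Fin 3) (Fin 3) ℂ) :
    pullback F (!![1, 0, 0; 0, 0, 0; 0, 0, 0] * N) = 0 := by
  have h1 : (fun i => ∑ j, MvPolynomial.C
      ((!![1, 0, 0; 0, 0, 0; 0, 0, 0] : Matrix (Fin 3) (Fin 3) ℂ) i j) *
      (MvPolynomial.X j : MvPolynomial (Fin 3) ℂ)) =
      fun i => (MvPolynomial.X 0 : MvPolynomial (Fin 3) ℂ) *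
        (algebraMap ℂ (MvPolynomial (Fin 3) ℂ) ((![1, 0, 0] : Fin 3 → ℂ) i)) := by
    funext i
    fin_cases i <;> simp [Fin.sum_univ_three]
  have h2 : MvPolynomial.aeval (fun i => algebraMap ℂ (MvPolynomial (Fin 3) ℂ)
      ((![1, 0, 0] : Fin 3 → ℂ) i)) F = 0 := by
    have h3 := MvPolynomial.aeval_algebraMap_apply (MvPolynomial (Fin 3) ℂ)
      (![1, 0, 0] : Fin 3 → ℂ) F
    rw [MvPolynomial.aeval_eq_eval] at h3
    rw [show MvPolynomial.eval ![1, 0, 0] F = 0 from hp, map_zero] at h3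
    exact h3
  rw [pullback_mul, pullback, h1, hFd.aeval_mul, h2, mul_zero, map_zero]

/-- The arc `α(t) N` consists of singular matrices and has the limit `G ∘ N = G`. Its value at `t =
0` is a nonzero matrix, because the first row of `N` is nonzero, and it annihilates `F` since `p`
lies on the curve. So the arc in the graph specializes to a point with second component `G`. -/
theorem isRankTwoLimit_of_pullback_eq {F G : MvPolynomial (Fin 3) ℂ} {d : ℕ}
    (hFd : F.IsHomogeneous d)
    (hp : MvPolynomial.eval ![1, 0, 0] F = 0) {b c : ℕ} {q r s : ℂ[X]}
    (hα : IsStandardForm b c q r s) (hG : IsFlatLimit F (standardGerm b c q r s) G)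
    (N : Matrix (Fin 3) (Fin 3) ℂ) (hN : N.det = 0) (hN0 : N 0 ≠ 0) (hGN : pullback G N = G) :
    IsRankTwoLimit F G := by
  obtain ⟨hG0, w, H, hH, hHG⟩ := hG
  set β := standardPoly b c q r s * N.map (Polynomial.C (R := ℂ)) with hβ
  have hβ0 : β.map (Polynomial.aeval (0 : ℂ)) = !![1, 0, 0; 0, 0, 0; 0, 0, 0] * N := by
    rw [hβ, ← standardPoly_map_eval_zero hα]
    ext i j
    simp [Matrix.mul_apply, Polynomial.eval_finsetSum]
  have hβs : β.map (Polynomial.coeToPowerSeries.algHom (R := ℂ) ℂ) =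
      standardGerm b c q r s * N.map (PowerSeries.C (R := ℂ)) := by
    rw [hβ, ← standardPoly_map_coe]
    ext i j : 1
    simp [Matrix.mul_apply]
  have hdet : ∀ t : ℂ, (β.map (Polynomial.aeval t)).det = 0 := by
    intro t
    have h : β.map (Polynomial.aeval t) = (standardPoly b c q r s).map (Polynomial.aeval t) * N := by
      rw [hβ]
      ext i j
      simp [Matrix.mul_apply, Polynomial.eval_finsetSum]
    rw [h, Matrix.det_mul, hN, mul_zero]
  have hk : ∀ m, ∃ k : ℂ[X], MvPolynomial.coeff m (pullback F β) = Polynomial.X ^ w * k ∧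
      k.eval 0 = MvPolynomial.coeff m G := by
    intro m
    set H' := linSubst (N.map (PowerSeries.C (R := ℂ))) H with hH'
    have h1 : pullback F (β.map (Polynomial.coeToPowerSeries.algHom (R := ℂ) ℂ)) =
        MvPolynomial.C (PowerSeries.X ^ w) * H' := by
      rw [hβs, pullback_mul, hH, map_mul, MvPolynomial.algHom_C, MvPolynomial.algebraMap_eq]
    have h2 : MvPolynomial.map (PowerSeries.constantCoeff (R := ℂ)) H' = G := by
      rw [hH', map_linSubst, hHG]
      have : (N.map (PowerSeries.C (R := ℂ))).map (PowerSeries.constantCoeff (R := ℂ)) = N := by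
        ext i j; simp
      rw [this, linSubst_eq_pullback, hGN]
    have h3 : ((MvPolynomial.coeff m (pullback F β) : ℂ[X]) : PowerSeries ℂ) =
        PowerSeries.X ^ w * MvPolynomial.coeff m H' := by
      rw [← MvPolynomial.coeff_C_mul, ← h1, ← map_pullback, MvPolynomial.coeff_map]
      simp
    have h4 : Polynomial.X ^ w ∣ MvPolynomial.coeff m (pullback F β) := by
      rw [Polynomial.X_pow_dvd_iff]
      intro i hi
      rw [← Polynomial.coeff_coe, h3, PowerSeries.coeff_X_pow_mul', if_neg (by omega)]
    obtain ⟨k, hk⟩ := h4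
    refine ⟨k, hk, ?_⟩
    rw [hk, Polynomial.coe_mul, Polynomial.coe_pow, Polynomial.coe_X] at h3
    have h5 := mul_left_cancel₀ (pow_ne_zero w PowerSeries.X_ne_zero) h3
    rw [← h2, MvPolynomial.coeff_map, ← h5, ← Polynomial.coeff_zero_eq_eval_zero,
      ← PowerSeries.coeff_zero_eq_constantCoeff_apply, Polynomial.coeff_coe]
  choose k hk hk0 using hk
  refine ⟨!![1, 0, 0; 0, 0, 0; 0, 0, 0] * N, pullback_cornerMatrix_mul hFd hp N, ?_, hG0, ?_⟩
  · intro h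
    apply hN0
    funext j
    have := congrFun (congrFun h 0) j
    simpa [Matrix.mul_apply, Fin.sum_univ_three] using this
  intro P hP
  obtain ⟨m₀, hm₀⟩ := MvPolynomial.ne_zero_iff.1 hG0
  have hkm : k m₀ ≠ 0 := by
    intro h
    rw [← hk0, h, Polynomial.eval_zero] at hm₀
    exact hm₀ rfl
  set Q : ℂ[X] := MvPolynomial.aeval (Sum.elim (fun p : Fin 3 × Fin 3 => β p.1 p.2) k) P with hQ
  have hQe : ∀ t : ℂ, Q.eval t =
      MvPolynomial.eval (Sum.elim (fun p : Fin 3 × Fin 3 => (β p.1 p.2).eval t)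
        (fun m => (k m).eval t)) P := by
    intro t
    rw [hQ, ← Polynomial.coe_aeval_eq_eval, ← AlgHom.comp_apply, MvPolynomial.comp_aeval,
      MvPolynomial.aeval_eq_eval]
    congr 2
    funext x
    rcases x with x | x <;> simp [Polynomial.coe_aeval_eq_eval]
  -- A polynomial vanishing on the graph over singular matrices vanishes along the arc wherever `t *
  -- k m₀(t) ≠ 0`, hence identically, hence at `t = 0`. Polynomial rather than power series entries
  -- are what make this evaluation possible.
  have hQ0 : Q = 0 := by
    have h : Q * (Polynomial.X * k m₀) = 0 := by
      refine Polynomial.funext fun t => ?_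
      rw [Polynomial.eval_mul, Polynomial.eval_zero, mul_eq_zero]
      by_cases ht : (Polynomial.X * k m₀).eval t = 0
      · exact Or.inr ht
      left
      rw [Polynomial.eval_mul, Polynomial.eval_X, mul_eq_zero, not_or] at ht
      have hc : ∀ m, MvPolynomial.coeff m (pullback F (β.map (Polynomial.aeval t))) =
          t ^ w * (k m).eval t := by
        intro m
        rw [← map_pullback, MvPolynomial.coeff_map, hk]
        simp
      have hne : pullback F (β.map (Polynomial.aeval t)) ≠ 0 := by
        intro h0
        have := hc m₀
        rw [h0, MvPolynomial.coeff_zero, eq_comm, mul_eq_zero] at this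
        exact this.elim (fun h => pow_ne_zero _ ht.1 h) ht.2
      rw [hQe, ← hP _ ((t ^ w)⁻¹) (hdet t) hne]
      congr 2
      funext x
      rcases x with x | x
      · simp [pairCoords, Polynomial.coe_aeval_eq_eval]
      · simp only [pairCoords, Sum.elim_inr, MvPolynomial.coeff_smul, hc, smul_eq_mul]
        rw [inv_mul_cancel_left₀ (pow_ne_zero _ ht.1)]
    exact (mul_eq_zero.1 h).resolve_right (mul_ne_zero Polynomial.X_ne_zero hkm)
  have h := hQe 0
  rw [hQ0, Polynomial.eval_zero] at h
  refine Eq.trans ?_ h.symm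
  rw [pairCoords, ← hβ0]
  congr 2
  funext x
  rcases x with x | x
  · simp
  · simp [hk0]

theorem pullback_diagonal_eq (G : MvPolynomial (Fin 3) ℂ) (e : Fin 3 → ℂ)
    (h : ∀ m, MvPolynomial.coeff m G ≠ 0 → ∏ i, e i ^ m i = 1) :
    pullback G (Matrix.diagonal e) = G := by
  have h1 : (fun i => ∑ j, MvPolynomial.C (Matrix.diagonal e i j) *
      (MvPolynomial.X j : MvPolynomial (Fin 3) ℂ)) =
      fun i => MvPolynomial.C (e i) * MvPolynomial.X i := by
    funext i
    rw [Finset.sum_eq_single i (fun j _ hj => by rw [Matrix.diagonal_apply_ne' _ hj, map_zero,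
      zero_mul]) (by simp), Matrix.diagonal_apply_eq]
  conv_rhs => rw [MvPolynomial.as_sum G]
  rw [pullback, h1, MvPolynomial.aeval_def, MvPolynomial.eval₂_eq']
  refine Finset.sum_congr rfl fun m hm => ?_
  simp only [mul_pow, Finset.prod_mul_distrib, ← map_pow, ← map_prod]
  rw [h m (MvPolynomial.mem_support_iff.1 hm), map_one, one_mul, MvPolynomial.monomial_eq,
    Finsupp.prod_fintype _ _ (by simp), MvPolynomial.algebraMap_eq]

/-- The polynomial `G(1, y ^ n, z)` in `z` over `ℂ[y]`. -/
noncomputable def dehom (n : ℕ) (G : MvPolynomial (Fin 3) ℂ) : ℂ[X][X] :=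
  MvPolynomial.aeval ![1, Polynomial.C (Polynomial.X ^ n), Polynomial.X] G

/-- In a form of degree `d` the exponent of `x` is forced by the other two, so no coefficients are
merged by dehomogenizing. -/
theorem coeff_dehom {G : MvPolynomial (Fin 3) ℂ} {d : ℕ} (hG : G.IsHomogeneous d) (n : ℕ)
    (hn : n ≠ 0) {m : Fin 3 →₀ ℕ} (hm : m 0 + m 1 + m 2 = d) :
    ((dehom n G).coeff (m 2)).coeff (n * m 1) = MvPolynomial.coeff m G := by
  rw [dehom, MvPolynomial.aeval_def, MvPolynomial.eval₂_eq', Polynomial.finsetSum_coeff,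
    Polynomial.finsetSum_coeff]
  have h : ∀ l : Fin 3 →₀ ℕ, ((algebraMap ℂ ℂ[X][X] (MvPolynomial.coeff l G) *
      ∏ i, (![1, Polynomial.C (Polynomial.X ^ n), Polynomial.X] : Fin 3 → ℂ[X][X]) i ^ l i).coeff
        (m 2)).coeff (n * m 1) =
      if m 2 = l 2 ∧ m 1 = l 1 then MvPolynomial.coeff l G else 0 := by
    intro l
    have h1 : (algebraMap ℂ ℂ[X][X] (MvPolynomial.coeff l G) *
      ∏ i, (![1, Polynomial.C (Polynomial.X ^ n), Polynomial.X] : Fin 3 → ℂ[X][X]) i ^ l i) =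
        Polynomial.C (Polynomial.C (MvPolynomial.coeff l G) * Polynomial.X ^ (n * l 1)) *
          Polynomial.X ^ l 2 := by
      simp [Fin.prod_univ_three, pow_mul, Polynomial.algebraMap_apply, mul_assoc]
    rw [h1, Polynomial.coeff_C_mul_X_pow]
    by_cases h2 : m 2 = l 2
    · rw [if_pos h2, Polynomial.coeff_C_mul_X_pow]
      simp [h2, hn]
    · rw [if_neg h2]; simp [h2]
  simp only [h]
  rw [Finset.sum_eq_single m]
  · simp
  · intro l hl hlm
    rw [if_neg]
    rintro ⟨h2, h1⟩
    apply hlm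
    have h3 := hG.sum_eq (MvPolynomial.mem_support_iff.1 hl)
    ext i
    fin_cases i <;> simp <;> omega
  · intro h
    rw [MvPolynomial.notMem_support_iff.1 h, ite_self]

theorem dehom_ne_zero {G : MvPolynomial (Fin 3) ℂ} {d : ℕ} (hG : G.IsHomogeneous d) (n : ℕ)
    (hn : n ≠ 0) (h0 : G ≠ 0) : dehom n G ≠ 0 := by
  obtain ⟨m, hm⟩ := MvPolynomial.ne_zero_iff.1 h0
  intro h
  rw [← coeff_dehom hG n hn (hG.sum_eq hm), h] at hm
  simp at hm

theorem isHomogeneous_pullback {R : Type*} [CommRing R] [Algebra ℂ R] {F : MvPolynomial (Fin 3) ℂ}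
    {d : ℕ} (hFd : F.IsHomogeneous d) (α : Matrix (Fin 3) (Fin 3) R) :
    (pullback F α).IsHomogeneous d := by
  have h := hFd.eval₂ (algebraMap ℂ (MvPolynomial (Fin 3) R))
    (fun i => ∑ j, MvPolynomial.C (α i j) * MvPolynomial.X j)
    (fun r => MvPolynomial.isHomogeneous_C _ (algebraMap ℂ R r)) (n := 1)
    (fun i => MvPolynomial.IsHomogeneous.sum _ _ _ fun j _ =>
      MvPolynomial.isHomogeneous_C_mul_X _ _)
  rw [one_mul] at h
  exact h

theorem IsFlatLimit.isHomogeneous {F G : MvPolynomial (Fin 3) ℂ} {d : ℕ} (hFd : F.IsHomogeneous d)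
    {α : Matrix (Fin 3) (Fin 3) (PowerSeries ℂ)} (hG : IsFlatLimit F α G) : G.IsHomogeneous d := by
  obtain ⟨-, w, H, hH, rfl⟩ := hG
  intro m hm
  refine isHomogeneous_pullback hFd α ?_
  rw [hH, MvPolynomial.coeff_C_mul]
  refine mul_ne_zero (pow_ne_zero _ PowerSeries.X_ne_zero) fun h => hm ?_
  rw [MvPolynomial.coeff_map, h, map_zero]

/-- Such a limit is free of `z`, hence fixed by `diag(1,1,0)`. -/
theorem isRankTwoLimit_of_natDegree_dehom_eq_zero {F G : MvPolynomial (Fin 3) ℂ} {d : ℕ}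
    (hFd : F.IsHomogeneous d)
    (hp : MvPolynomial.eval ![1, 0, 0] F = 0) {b c : ℕ} {q r s : ℂ[X]}
    (hα : IsStandardForm b c q r s) (hG : IsFlatLimit F (standardGerm b c q r s) G)
    (n : ℕ) (hn : n ≠ 0) (h : (dehom n G).natDegree = 0) : IsRankTwoLimit F G := by
  have hGd := hG.isHomogeneous hFd
  refine isRankTwoLimit_of_pullback_eq hFd hp hα hG (Matrix.diagonal ![1, 1, 0])
    (by simp [Matrix.det_diagonal, Fin.prod_univ_three])
    (fun h => by simpa using congrFun h 0) (pullback_diagonal_eq _ _ fun m hm => ?_)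
  have h2 : m 2 = 0 := by
    by_contra h2
    rw [← coeff_dehom hGd n hn (hGd.sum_eq hm), Polynomial.coeff_eq_zero_of_natDegree_lt
      (p := dehom n G) (by omega)] at hm
    simp at hm
  simp [Fin.prod_univ_three, h2]

/-- The range is `ℂ[z]` inside `ℂ[y][z]`: the limit is free of `y`, hence fixed by `diag(1,0,1)`. -/
theorem isRankTwoLimit_of_dehom_mem_range {F G : MvPolynomial (Fin 3) ℂ} {d : ℕ}
    (hFd : F.IsHomogeneous d)
    (hp : MvPolynomial.eval ![1, 0, 0] F = 0) {b c : ℕ} {q r s : ℂ[X]}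
    (hα : IsStandardForm b c q r s) (hG : IsFlatLimit F (standardGerm b c q r s) G)
    (h : dehom 1 G ∈ (Polynomial.mapRingHom (Polynomial.C (R := ℂ))).range) :
    IsRankTwoLimit F G := by
  have hGd := hG.isHomogeneous hFd
  refine isRankTwoLimit_of_pullback_eq hFd hp hα hG (Matrix.diagonal ![1, 0, 1])
    (by simp [Matrix.det_diagonal, Fin.prod_univ_three])
    (fun h => by simpa using congrFun h 0) (pullback_diagonal_eq _ _ fun m hm => ?_)
  obtain ⟨g, hg⟩ := h
  have h1 : m 1 = 0 := by
    by_contra h1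
    rw [← coeff_dehom hGd 1 one_ne_zero (hGd.sum_eq hm), ← hg] at hm
    rw [Polynomial.coe_mapRingHom, Polynomial.coeff_map, one_mul, Polynomial.coeff_C_of_ne_zero h1] at hm
    exact hm rfl
  simp [Fin.prod_univ_three, h1]

/-! ### The limit as a product of initial forms -/

namespace PowerSeries

theorem constantCoeff_X_pow {A : Type*} [CommRing A] {n : ℕ} (hn : n ≠ 0) :
    constantCoeff ((X : A⟦X⟧) ^ n) = 0 := by
  simp [hn]

/-- The substitution `t = X ^ N`, with values in the series over `ℂ[y][z]`. -/
noncomputable def ramify (N : ℕ) (hN : N ≠ 0) : ℂ⟦X⟧ →ₐ[ℂ] ℂ[X][X]⟦X⟧ :=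
  substHom (X ^ N) (constantCoeff_X_pow hN)

theorem coeff_ramify_mul (N : ℕ) (hN : N ≠ 0) (f : ℂ⟦X⟧) (i : ℕ) :
    coeff (N * i) (ramify N hN f) = Polynomial.C (Polynomial.C (coeff i f)) := by
  rw [ramify, substHom_apply, coeff_subst_X_pow hN]
  simp [Polynomial.algebraMap_apply, Nat.mul_div_cancel_left i (Nat.pos_of_ne_zero hN)]

theorem coeff_ramify_of_not_dvd (N : ℕ) (hN : N ≠ 0) (f : ℂ⟦X⟧) {i : ℕ} (hi : ¬ N ∣ i) :
    coeff i (ramify N hN f) = 0 := by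
  rw [ramify, substHom_apply, coeff_subst_X_pow hN, if_neg hi]

/-- The second coordinate `q(t) + t ^ b * y` of the moving point, with `t = X ^ N` and `y` replaced
by `y ^ n`. -/
noncomputable def coordY (N : ℕ) (hN : N ≠ 0) (n b : ℕ) (q : ℂ[X]) : ℂ[X][X]⟦X⟧ :=
  ramify N hN q + X ^ (N * b) * C (Polynomial.C (Polynomial.X ^ n))

/-- The part `r(t) + s(t) * t ^ b * y` of the third coordinate of the moving point, with `t = X ^ N`
and `y` replaced by `y ^ n`. -/
noncomputable def coordW (N : ℕ) (hN : N ≠ 0) (n b : ℕ) (r s : ℂ[X]) : ℂ[X][X]⟦X⟧ :=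
  ramify N hN r + ramify N hN s * X ^ (N * b) * C (Polynomial.C (Polynomial.X ^ n))

/-- The third coordinate `r(t) + s(t) * t ^ b * y + t ^ c * z` of the moving point, with `t = X ^ N`
and `y` replaced by `y ^ n`. -/
noncomputable def coordZ (N : ℕ) (hN : N ≠ 0) (n b c : ℕ) (r s : ℂ[X]) : ℂ[X][X]⟦X⟧ :=
  coordW N hN n b r s + X ^ (N * c) * C Polynomial.X

/-- The common power `t^w` becomes `X^(N w)`, and what is left has constant term `dehom n G ≠ 0`,
which is therefore the lowest coefficient. -/
theorem lead_aeval_coord {F G : MvPolynomial (Fin 3) ℂ} {d : ℕ} (hFd : F.IsHomogeneous d)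
    {b c : ℕ} {q r s : ℂ[X]} (hG : IsFlatLimit F (standardGerm b c q r s) G) (N : ℕ) (hN : N ≠ 0)
    (n : ℕ) (hn : n ≠ 0) :
    lead (MvPolynomial.aeval ![1, coordY N hN n b q, coordZ N hN n b c r s] F) = dehom n G := by
  have hGd := hG.isHomogeneous hFd
  obtain ⟨hG0, w, H, hH, hHG⟩ := hG
  set v : Fin 3 → ℂ[X][X]⟦X⟧ := ![1, C (Polynomial.C (Polynomial.X ^ n)), C Polynomial.X] with hv
  set Θ := MvPolynomial.eval₂Hom (ramify N hN : ℂ⟦X⟧ →+* ℂ[X][X]⟦X⟧) v with hΘ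
  have h1 : ∀ α : Matrix (Fin 3) (Fin 3) ℂ⟦X⟧, Θ (pullback F α) =
      MvPolynomial.aeval (fun i => ∑ j, ramify N hN (α i j) * v j) F := by
    intro α
    have h : (Θ.comp (MvPolynomial.aeval (R := ℂ) (fun i => ∑ j, MvPolynomial.C (α i j) *
        MvPolynomial.X j) : MvPolynomial (Fin 3) ℂ →+* MvPolynomial (Fin 3) ℂ⟦X⟧)) =
        (MvPolynomial.aeval (fun i => ∑ j, ramify N hN (α i j) * v j) :
          MvPolynomial (Fin 3) ℂ →ₐ[ℂ] ℂ[X][X]⟦X⟧) := by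
      apply MvPolynomial.ringHom_ext
      · intro a
        have := (ramify N hN).commutes a
        simpa [hΘ, MvPolynomial.algHom_C, IsScalarTower.algebraMap_apply ℂ ℂ⟦X⟧] using this
      · intro i
        simp [hΘ]
    exact DFunLike.congr_fun h F
  have h2 : constantCoeff (Θ H) = dehom n G := by
    have h : (constantCoeff (R := ℂ[X][X])).comp Θ =
        (MvPolynomial.aeval ![1, Polynomial.C (Polynomial.X ^ n), Polynomial.X] :
          MvPolynomial (Fin 3) ℂ →ₐ[ℂ] ℂ[X][X]).toRingHom.comp
          (MvPolynomial.map (constantCoeff (R := ℂ))) := by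
      apply MvPolynomial.ringHom_ext
      · intro a
        simp [hΘ, ramify]
      · intro i
        fin_cases i <;> simp [hΘ, hv]
    rw [dehom, ← hHG]
    exact DFunLike.congr_fun h H
  have h3 := h1 (standardGerm b c q r s)
  rw [hH, map_mul] at h3
  have h4 : Θ (MvPolynomial.C (X ^ w)) = X ^ (N * w) := by
    simp [hΘ, ramify, pow_mul]
  have h5 : (fun i => ∑ j, ramify N hN (standardGerm b c q r s i j) * v j) =
      ![1, coordY N hN n b q, coordZ N hN n b c r s] := by
    funext i
    fin_cases i
    · simp [standardGerm, Fin.sum_univ_three, hv]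
    · simp [standardGerm, Fin.sum_univ_three, hv, coordY, ramify, pow_mul]
    · simp [standardGerm, Fin.sum_univ_three, hv, coordZ, coordW, ramify, pow_mul]
  rw [h4, h5] at h3
  rw [← h3, lead_X_pow_mul, h2]
  rw [h2]
  exact dehom_ne_zero hGd n hn hG0

theorem constantCoeff_coordZ {b c : ℕ} {q r s : ℂ[X]} (h : IsStandardForm b c q r s) (N : ℕ)
    (hN : N ≠ 0) (n : ℕ) : constantCoeff (coordZ N hN n b c r s) = 0 := by
  have h1 := h.one_le
  have h2 := h.le
  have h3 := h.r_zero
  rw [← Polynomial.coeff_zero_eq_eval_zero] at h3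
  have hb : b ≠ 0 := by omega
  have hc : c ≠ 0 := by omega
  simp [coordZ, coordW, hN, hb, hc, ramify, h3]

/-- Substitute `X ↦ T`, `z ↦ Z` in the Puiseux factorization and take lowest coefficients. The
exponent `n` leaves room for an `N`-th root of `Y` when `q = 0`, where `y` itself must be an `N`-th
power; for `q ≠ 0` the choice `n = 1` suffices. -/
theorem exists_branches {F G : MvPolynomial (Fin 3) ℂ} (hF : F ≠ 0) {d : ℕ}
    (hFd : F.IsHomogeneous d) {b c : ℕ} {q r s : ℂ[X]} (hα : IsStandardForm b c q r s)
    (hG : IsFlatLimit F (standardGerm b c q r s) G) :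
    ∃ (N : ℕ) (hN : N ≠ 0) (φs : Multiset ℂ⟦X⟧),
      (∀ φ ∈ φs, constantCoeff φ = 0 ∧ MvPolynomial.aeval ![1, (X : ℂ⟦X⟧) ^ N, φ] F = 0) ∧
      ∀ n ≠ 0, ∀ (T : ℂ[X][X]⟦X⟧) (hT : constantCoeff T = 0), T ≠ 0 →
        T ^ N = coordY N hN n b q → ∃ (κ μ : ℂ) (i j : ℕ), κ ≠ 0 ∧ μ ≠ 0 ∧
          algebraMap ℂ ℂ[X][X] κ * lead T ^ i * dehom n G =
            algebraMap ℂ ℂ[X][X] μ * lead T ^ j *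
              (φs.map fun φ => lead (coordZ N hN n b c r s - substHom T hT φ)).prod := by
  set P : ℂ⟦X⟧[X] := MvPolynomial.aeval ![1, Polynomial.C X, Polynomial.X] F with hP
  have hP0 : P ≠ 0 := by
    have h : P = (dehom 1 F).map (Polynomial.coeToPowerSeries.ringHom (R := ℂ)) := by
      have h1 : (Polynomial.mapRingHom (Polynomial.coeToPowerSeries.ringHom (R := ℂ))).comp
          ((MvPolynomial.aeval ![1, Polynomial.C (Polynomial.X ^ 1), Polynomial.X] :
          MvPolynomial (Fin 3) ℂ →ₐ[ℂ] ℂ[X][X]) : MvPolynomial (Fin 3) ℂ →+* ℂ[X][X]) =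
          ((MvPolynomial.aeval ![1, Polynomial.C X, Polynomial.X] :
          MvPolynomial (Fin 3) ℂ →ₐ[ℂ] ℂ⟦X⟧[X]) : MvPolynomial (Fin 3) ℂ →+* ℂ⟦X⟧[X]) := by
        apply MvPolynomial.ringHom_ext
        · intro a
          simp [Polynomial.algebraMap_apply, MvPolynomial.algHom_C]
        · intro i
          fin_cases i <;> simp
      exact (DFunLike.congr_fun h1 F).symm
    rw [h, Ne, Polynomial.map_eq_zero_iff (Polynomial.coe_injective ℂ)]
    exact dehom_ne_zero hFd 1 one_ne_zero hF
  obtain ⟨N, hN, U, v, ws, φs, hU, hv, hφ, hprod⟩ := exists_puiseux_factorization _ P hP0 rfl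
  refine ⟨N, hN, φs, fun φ hφs => ⟨hφ φ hφs, ?_⟩, ?_⟩
  · have h1 : (P.map (expandHom N hN)).eval φ = MvPolynomial.aeval ![1, (X : ℂ⟦X⟧) ^ N, φ] F := by
      have h2 : (Polynomial.eval₂RingHom (expandHom (k := ℂ) N hN) φ).comp
          ((MvPolynomial.aeval ![1, Polynomial.C X, Polynomial.X] :
          MvPolynomial (Fin 3) ℂ →ₐ[ℂ] ℂ⟦X⟧[X]) : MvPolynomial (Fin 3) ℂ →+* ℂ⟦X⟧[X]) =
          ((MvPolynomial.aeval ![1, (X : ℂ⟦X⟧) ^ N, φ] :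
          MvPolynomial (Fin 3) ℂ →ₐ[ℂ] ℂ⟦X⟧) : MvPolynomial (Fin 3) ℂ →+* ℂ⟦X⟧) := by
        apply MvPolynomial.ringHom_ext
        · intro a
          simp [Polynomial.algebraMap_apply, MvPolynomial.algHom_C, expand_C]
        · intro i
          fin_cases i <;> simp
      rw [Polynomial.eval_map]
      exact DFunLike.congr_fun h2 F
    have h2 := congrArg (Polynomial.eval φ) hprod
    rw [Polynomial.eval_mul, Polynomial.eval_C, h1, Polynomial.eval_mul] at h2
    have h3 : (φs.map fun φ => Polynomial.X - Polynomial.C φ).prod.eval φ = 0 :=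
      Polynomial.eval_eq_zero_of_dvd_of_eval_eq_zero
        (Multiset.dvd_prod (Multiset.mem_map_of_mem _ hφs)) (by simp)
    rw [h3, mul_zero, mul_eq_zero] at h2
    exact h2.resolve_left hU
  · intro n hn T hT hT0 hTN
    have hZ := constantCoeff_coordZ hα N hN n
    set Z := coordZ N hN n b c r s with hZdef
    set e : ℂ⟦X⟧ →+* ℂ[X][X]⟦X⟧ := RingHomClass.toRingHom
      (substHom T hT : ℂ⟦X⟧ →ₐ[ℂ] ℂ[X][X]⟦X⟧) with he
    have h1 : Polynomial.eval₂ e Z (P.map (expandHom N hN)) =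
        MvPolynomial.aeval ![1, coordY N hN n b q, Z] F := by
      have h2 : (Polynomial.eval₂RingHom (e.comp (expandHom (k := ℂ) N hN)) Z).comp
          ((MvPolynomial.aeval ![1, Polynomial.C X, Polynomial.X] :
          MvPolynomial (Fin 3) ℂ →ₐ[ℂ] ℂ⟦X⟧[X]) : MvPolynomial (Fin 3) ℂ →+* ℂ⟦X⟧[X]) =
          ((MvPolynomial.aeval ![1, coordY N hN n b q, Z] :
          MvPolynomial (Fin 3) ℂ →ₐ[ℂ] ℂ[X][X]⟦X⟧) : MvPolynomial (Fin 3) ℂ →+* ℂ[X][X]⟦X⟧) := by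
        apply MvPolynomial.ringHom_ext
        · intro a
          simp [Polynomial.algebraMap_apply, MvPolynomial.algHom_C, algebraMap_apply, expand_C, he]
        · intro i
          fin_cases i <;> simp [he, hTN]
      rw [Polynomial.eval₂_map]
      exact DFunLike.congr_fun h2 F
    have h2 := congrArg (fun p => lead (Polynomial.eval₂ e Z p)) hprod
    simp only [Polynomial.eval₂_mul, h1, map_mul, Polynomial.eval₂_C] at h2
    -- Since `Z` has no constant term, each factor `1 - w(T) Z` has lowest coefficient `1`.
    have h3 : lead (Polynomial.eval₂ e Z
        (ws.map fun w => 1 - Polynomial.C w * Polynomial.X).prod) = 1 := by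
      rw [← Polynomial.coe_eval₂RingHom, map_multiset_prod, map_multiset_prod, Multiset.map_map,
        Multiset.map_map]
      refine Multiset.prod_eq_one fun x hx => ?_
      obtain ⟨w, -, rfl⟩ := Multiset.mem_map.1 hx
      have : constantCoeff (1 - e w * Z) = 1 := by simp [hZ]
      simp only [Function.comp_apply, Polynomial.coe_eval₂RingHom, Polynomial.eval₂_sub,
        Polynomial.eval₂_one, Polynomial.eval₂_mul, Polynomial.eval₂_C, Polynomial.eval₂_X]
      rw [lead_eq_constantCoeff (by rw [this]; exact one_ne_zero), this]
    have h4 : lead (Polynomial.eval₂ e Z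
        (φs.map fun φ => Polynomial.X - Polynomial.C φ).prod) =
        (φs.map fun φ => lead (Z - substHom T hT φ)).prod := by
      rw [← Polynomial.coe_eval₂RingHom, map_multiset_prod, map_multiset_prod, Multiset.map_map,
        Multiset.map_map]
      congr 1
      refine Multiset.map_congr rfl fun φ _ => ?_
      simp [he]
    rw [h3, h4, mul_one] at h2
    refine ⟨lead U, lead v, U.order.toNat, v.order.toNat, lead_ne_zero hU, lead_ne_zero hv, ?_⟩
    rw [← (substHom_ne_zero_and_lead hT0 hT hU).2.2, ← (substHom_ne_zero_and_lead hT0 hT hv).2.2,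
      ← lead_aeval_coord hFd hG N hN n hn]
    exact h2

end PowerSeries

/-! ### Coefficientwise derivatives and the chain rule -/

namespace PowerSeries

theorem map_substHom {k A A' : Type*} [CommRing k] [CommRing A] [CommRing A'] [Algebra k A]
    [Algebra k A'] (g : A →ₐ[k] A') (T : A⟦X⟧) (hT : constantCoeff T = 0)
    (hT' : constantCoeff (map (g : A →+* A') T) = 0) (f : k⟦X⟧) :
    map (g : A →+* A') (substHom T hT f) = substHom (map (g : A →+* A') T) hT' f := by
  ext n
  have h1 : HasSubst T := HasSubst.of_constantCoeff_zero' hT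
  have h2 : HasSubst (map (g : A →+* A') T) := HasSubst.of_constantCoeff_zero' hT'
  rw [coeff_map, substHom_apply, substHom_apply, coeff_subst' h1, coeff_subst' h2]
  refine (AddMonoidHom.map_finsum (g : A →+* A').toAddMonoidHom
    (coeff_subst_finite' h1 f n)).trans (finsum_congr fun d => ?_)
  rw [← map_pow, coeff_map]
  simp

theorem substHom_substHom {k A B : Type*} [CommRing k] [CommRing A] [CommRing B] [Algebra k A]
    [Algebra k B] [Algebra A B] [IsScalarTower k A B] (S : A⟦X⟧) (hS : constantCoeff S = 0)
    (T : B⟦X⟧) (hT : constantCoeff T = 0) (hST : constantCoeff (substHom (k := A) T hT S) = 0)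
    (f : k⟦X⟧) :
    substHom (k := A) T hT (substHom S hS f) = substHom (substHom (k := A) T hT S) hST f := by
  simp only [substHom_apply]
  exact subst_comp_subst_apply (HasSubst.of_constantCoeff_zero' hS)
    (HasSubst.of_constantCoeff_zero' hT) f

theorem expand_eq_substHom {k : Type*} [CommRing k] (N : ℕ) (hN : N ≠ 0) (f : k⟦X⟧) :
    expand N hN f = substHom (X ^ N) (constantCoeff_X_pow hN) f := by
  rw [expand_apply, substHom_apply]

theorem substHom_congr {k A : Type*} [CommRing k] [CommRing A] [Algebra k A] {S T : A⟦X⟧}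
    (h : S = T) (hS : constantCoeff S = 0) (hT : constantCoeff T = 0) (f : k⟦X⟧) :
    substHom S hS f = substHom T hT f := by
  subst h; rfl

theorem substHom_expand {k A : Type*} [CommRing k] [CommRing A] [Algebra k A] (T : A⟦X⟧)
    (hT : constantCoeff T = 0) (N : ℕ) (hN : N ≠ 0) (f : k⟦X⟧) :
    substHom T hT (expand N hN f) = substHom (T ^ N) (by simp [hT, hN]) f := by
  rw [expand_eq_substHom, substHom_substHom (k := k) (A := k) (hST := by simp [hT, hN])]
  exact substHom_congr (by simp) _ _ _

theorem expand_substHom {k : Type*} [CommRing k] (T : k⟦X⟧)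
    (hT : constantCoeff T = 0) (N : ℕ) (hN : N ≠ 0) (f : k⟦X⟧) :
    expand N hN (substHom T hT f) = substHom (expand N hN T) (by simp [hT]) f := by
  rw [expand_eq_substHom, substHom_substHom (k := k) (A := k) (hST := by simp [hT])]
  exact substHom_congr (expand_eq_substHom N hN T).symm _ _ _

/-- The derivation of `ℂ[y]⟦X⟧` that differentiates the coefficients with respect to `y`. -/
noncomputable def coeffDeriv : Derivation ℂ ℂ[X]⟦X⟧ ℂ[X]⟦X⟧ :=
  Derivation.mk'
    { toFun := fun f => mk fun n => Polynomial.derivative (coeff n f)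
      map_add' := fun f g => by ext1 n; simp
      map_smul' := fun a f => by ext1 n; simp }
    (fun f g => by
      ext1 n
      simp only [LinearMap.coe_mk, AddHom.coe_mk, coeff_mk, smul_eq_mul, map_add, coeff_mul,
        Polynomial.derivative_sum, Polynomial.derivative_mul, Finset.sum_add_distrib]
      rw [add_comm]
      congr 1
      rw [← Finset.Nat.sum_antidiagonal_swap]
      exact Finset.sum_congr rfl fun p _ => mul_comm _ _)

theorem coeff_coeffDeriv (f : ℂ[X]⟦X⟧) (n : ℕ) :
    coeff n (coeffDeriv f) = Polynomial.derivative (coeff n f) := by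
  simp [coeffDeriv]

theorem X_pow_dvd_coeffDeriv {f : ℂ[X]⟦X⟧} {n : ℕ} (h : X ^ n ∣ f) : X ^ n ∣ coeffDeriv f := by
  rw [X_pow_dvd_iff] at h ⊢
  intro m hm
  rw [coeff_coeffDeriv, h m hm, Polynomial.derivative_zero]

theorem coeffDeriv_C (p : ℂ[X]) : coeffDeriv (C p) = C (Polynomial.derivative p) := by
  ext1 n
  rw [coeff_coeffDeriv, coeff_C, coeff_C]
  split_ifs <;> simp

theorem coeffDeriv_X_pow (n : ℕ) : coeffDeriv (X ^ n) = 0 := by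
  ext1 m
  rw [coeff_coeffDeriv, coeff_X_pow]
  split_ifs <;> simp

theorem coeffDeriv_map_C (f : ℂ⟦X⟧) : coeffDeriv (map Polynomial.C f) = 0 := by
  ext1 m
  rw [coeff_coeffDeriv, coeff_map, Polynomial.derivative_C, map_zero]

/-- The operator `X d/dX` on power series. -/
noncomputable def euler (f : ℂ⟦X⟧) : ℂ⟦X⟧ := mk fun n => (n : ℂ) * coeff n f

@[simp]
theorem coeff_euler (f : ℂ⟦X⟧) (n : ℕ) : coeff n (euler f) = n * coeff n f := coeff_mk _ _

theorem euler_C_add_X_mul (c : ℂ) (f : ℂ⟦X⟧) :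
    euler (C c + X * f) = X * f + X * euler f := by
  ext n
  cases n with
  | zero => simp
  | succ n =>
    simp only [coeff_euler, map_add, coeff_C, coeff_succ_X_mul]
    rw [if_neg (by omega)]
    push_cast
    ring

theorem order_euler {f : ℂ⟦X⟧} (hf : constantCoeff f = 0) : (euler f).order = f.order := by
  by_cases h0 : f = 0
  · subst h0; congr 1; ext; simp
  rw [← coe_toNat_order h0]
  refine order_eq_of_coeff (fun i hi => ?_) ?_
  · rw [coeff_euler, coeff_of_lt_order_toNat i hi, mul_zero]
  · rw [coeff_euler]
    refine mul_ne_zero ?_ (coeff_order h0)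
    rw [Nat.cast_ne_zero]
    intro h
    have := coeff_order h0
    rw [h, coeff_zero_eq_constantCoeff_apply, hf] at this
    exact this rfl

/-- The chain rule, multiplied by `T`. -/
theorem mul_coeffDeriv_substHom (T : ℂ[X]⟦X⟧) (hT : constantCoeff T = 0) (f : ℂ⟦X⟧) :
    T * coeffDeriv (substHom T hT f) = coeffDeriv T * substHom T hT (euler f) := by
  -- Writing `f = c + X g` reduces the identity for `f` to `T` times the identity for `g`. Each
  -- round gains a factor `X`, so the difference is divisible by every power of `X`.
  have h : ∀ (M : ℕ) (f : ℂ⟦X⟧),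
      X ^ M ∣ T * coeffDeriv (substHom T hT f) - coeffDeriv T * substHom T hT (euler f) := by
    intro M
    induction M with
    | zero => simp
    | succ M ih =>
      intro f
      obtain ⟨g, hg⟩ : ∃ g, f = C (constantCoeff f) + X * g := by
        obtain ⟨g, hg⟩ := X_dvd_iff.2 (show constantCoeff (f - C (constantCoeff f)) = 0 by simp)
        exact ⟨g, by rw [← hg]; ring⟩
      have h1 : T * coeffDeriv (substHom T hT f) - coeffDeriv T * substHom T hT (euler f) =
          T * (T * coeffDeriv (substHom T hT g) - coeffDeriv T * substHom T hT (euler g)) := by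
        rw [hg, euler_C_add_X_mul]
        simp only [map_add, map_mul, substHom_X, substHom_C, Derivation.leibniz, smul_eq_mul,
          coeffDeriv_C, Polynomial.algebraMap_apply, Polynomial.derivative_C, map_zero,
          Algebra.algebraMap_self, RingHom.id_apply]
        ring
      rw [h1, pow_succ']
      exact mul_dvd_mul (X_dvd_iff.2 hT) (ih g)
  rw [← sub_eq_zero]
  ext1 n
  exact X_pow_dvd_iff.1 (h (n + 1) f) n n.lt_succ_self

/-- The chain rule for `T` with `T ^ N = Y`, `∂Y/∂y = D`. -/
theorem coeffDeriv_substHom (T : ℂ[X]⟦X⟧) (hT : constantCoeff T = 0) {N : ℕ} (hN : N ≠ 0)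
    {D : ℂ[X]⟦X⟧} (hD : coeffDeriv (T ^ N) = D) (f : ℂ⟦X⟧) :
    N * T ^ N * coeffDeriv (substHom T hT f) = D * substHom T hT (euler f) := by
  obtain ⟨n, rfl⟩ := Nat.exists_eq_succ_of_ne_zero hN
  have h := mul_coeffDeriv_substHom T hT f
  rw [Derivation.leibniz_pow, Nat.add_one_sub_one, smul_eq_mul, nsmul_eq_mul] at hD
  rw [← hD, pow_succ]
  linear_combination (((n + 1 : ℕ) : ℂ[X]⟦X⟧) * T ^ n) * h

/-- Differentiating the first-order rule once more, with `D` constant in `y`, produces the operator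
`E(E - N)` for `E = X d/dX`. -/
theorem coeffDeriv_coeffDeriv_substHom (T : ℂ[X]⟦X⟧) (hT : constantCoeff T = 0) {N : ℕ}
    (hN : N ≠ 0) {D : ℂ[X]⟦X⟧} (hD : coeffDeriv (T ^ N) = D) (hD0 : coeffDeriv D = 0) (f : ℂ⟦X⟧) :
    (N : ℂ[X]⟦X⟧) ^ 2 * (T ^ N) ^ 2 * coeffDeriv (coeffDeriv (substHom T hT f)) =
      D ^ 2 * substHom T hT (euler (euler f) - (N : ℂ⟦X⟧) * euler f) := by
  have h1 := coeffDeriv_substHom T hT hN hD f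
  have h2 := coeffDeriv_substHom T hT hN hD (euler f)
  have h3 := congrArg coeffDeriv h1
  simp only [Derivation.leibniz, smul_eq_mul, hD, hD0, Derivation.map_natCast] at h3
  rw [map_sub, map_mul, map_natCast]
  linear_combination (N * T ^ N) * h3 + D * h2 - N * D * h1

end PowerSeries

/-! ### Initial forms -/

namespace PowerSeries

/-- The term `X^m z` starts too late to reach the lowest coefficient, so without contact a factor
contributes no `z`. -/
theorem lead_map_C_add_of_not_dvd {E : ℂ[X]⟦X⟧} {m : ℕ} (h : ¬ X ^ m ∣ E) :
    lead (map Polynomial.C E + X ^ m * C Polynomial.X) = Polynomial.C (lead E) := by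
  have hE : E ≠ 0 := fun h0 => h (h0 ▸ dvd_zero _)
  have hlt : E.order.toNat < m := by
    by_contra hle
    apply h
    rw [X_pow_dvd_iff]
    exact fun i hi => coeff_of_lt_order_toNat i (by omega)
  have hc : ∀ i ≤ E.order.toNat, coeff i (map Polynomial.C E + X ^ m * C Polynomial.X) =
      Polynomial.C (coeff i E) := by
    intro i hi
    rw [map_add, coeff_map, coeff_X_pow_mul', if_neg (by omega), add_zero]
  rw [lead_apply E, ← hc _ le_rfl]
  refine lead_eq_coeff (fun i hi => ?_) ?_
  · rw [hc i hi.le, coeff_of_lt_order_toNat i hi, map_zero]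
  · rw [hc _ le_rfl, Ne, Polynomial.C_eq_zero]
    exact coeff_order hE

theorem lead_map_C_add_of_dvd {E : ℂ[X]⟦X⟧} {m : ℕ} (h : X ^ m ∣ E) :
    lead (map Polynomial.C E + X ^ m * C Polynomial.X) =
      Polynomial.C (coeff m E) + Polynomial.X := by
  have hm : coeff m (map Polynomial.C E + X ^ m * C Polynomial.X) =
      Polynomial.C (coeff m E) + Polynomial.X := by
    rw [map_add, coeff_map, coeff_X_pow_mul', if_pos le_rfl, Nat.sub_self, coeff_zero_C]
  rw [← hm]
  refine lead_eq_coeff (fun i hi => ?_) ?_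
  · rw [map_add, coeff_map, coeff_X_pow_mul', if_neg (by omega), add_zero,
      X_pow_dvd_iff.1 h i hi, map_zero]
  · rw [hm, add_comm]
    exact Polynomial.X_add_C_ne_zero _

theorem ramify_eq_map (N : ℕ) (hN : N ≠ 0) (f : ℂ⟦X⟧) :
    ramify N hN f = map Polynomial.C (map Polynomial.C (expand N hN f)) := by
  ext1 i
  rw [coeff_map, coeff_map]
  by_cases hi : N ∣ i
  · obtain ⟨j, rfl⟩ := hi
    rw [coeff_ramify_mul, coeff_expand_mul]
  · rw [coeff_ramify_of_not_dvd N hN f hi, coeff_expand_of_not_dvd _ _ _ hi, map_zero, map_zero]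

/-- The series `coordY` as a series over `ℂ[y]`. -/
noncomputable def planeY (N : ℕ) (hN : N ≠ 0) (n b : ℕ) (q : ℂ[X]) : ℂ[X]⟦X⟧ :=
  map Polynomial.C (expand N hN (q : ℂ⟦X⟧)) + X ^ (N * b) * C (Polynomial.X ^ n)

/-- The series `coordW` as a series over `ℂ[y]`. -/
noncomputable def planeW (N : ℕ) (hN : N ≠ 0) (n b : ℕ) (r s : ℂ[X]) : ℂ[X]⟦X⟧ :=
  map Polynomial.C (expand N hN (r : ℂ⟦X⟧)) +
    map Polynomial.C (expand N hN (s : ℂ⟦X⟧)) * X ^ (N * b) * C (Polynomial.X ^ n)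

theorem coordY_eq_map (N : ℕ) (hN : N ≠ 0) (n b : ℕ) (q : ℂ[X]) :
    coordY N hN n b q = map Polynomial.C (planeY N hN n b q) := by
  simp [coordY, planeY, ramify_eq_map]

theorem coordW_eq_map (N : ℕ) (hN : N ≠ 0) (n b : ℕ) (r s : ℂ[X]) :
    coordW N hN n b r s = map Polynomial.C (planeW N hN n b r s) := by
  simp [coordW, planeW, ramify_eq_map]

theorem coordZ_sub_substHom (N : ℕ) (hN : N ≠ 0) (n b c : ℕ) (r s : ℂ[X]) (T : ℂ[X]⟦X⟧)
    (hT : constantCoeff T = 0) (hT' : constantCoeff (map Polynomial.C T) = 0) (φ : ℂ⟦X⟧) :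
    coordZ N hN n b c r s - substHom (map Polynomial.C T) hT' φ =
      map Polynomial.C (planeW N hN n b r s - substHom T hT φ) + X ^ (N * c) * C Polynomial.X := by
  have h := map_substHom (Algebra.ofId ℂ[X] ℂ[X][X] |>.restrictScalars ℂ) T hT hT' φ
  have h' : map Polynomial.C (substHom T hT φ) = substHom (map Polynomial.C T) hT' φ := h
  rw [map_sub, h', coordZ, coordW_eq_map]
  ring

theorem coeff_coeff_substHom_monomial (b : ℕ)
    (hT : constantCoeff (X ^ b * C (Polynomial.X : ℂ[X])) = 0) (φ : ℂ⟦X⟧) (i l : ℕ) :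
    (coeff i (substHom (X ^ b * C (Polynomial.X : ℂ[X])) hT φ)).coeff l =
      if i = b * l then coeff l φ else 0 := by
  have hs := HasSubst.of_constantCoeff_zero' hT
  have h : ∀ d, coeff d φ • coeff i ((X ^ b * C (Polynomial.X : ℂ[X])) ^ d) =
      if i = b * d then Polynomial.C (coeff d φ) * Polynomial.X ^ d else 0 := by
    intro d
    rw [mul_pow, ← pow_mul, ← map_pow, mul_comm, coeff_C_mul, coeff_X_pow]
    split_ifs with h
    · rw [mul_one, Polynomial.smul_eq_C_mul]
    · simp
  rw [substHom_apply, coeff_subst' hs]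
  simp only [h]
  have h2 := AddMonoidHom.map_finsum (Polynomial.lcoeff ℂ l).toAddMonoidHom
    (f := fun d => if i = b * d then Polynomial.C (coeff d φ) * Polynomial.X ^ d else 0)
    (by simpa only [h] using coeff_subst_finite' hs φ i)
  refine h2.trans ?_
  have h3 : ∀ d, (Polynomial.lcoeff ℂ l).toAddMonoidHom
      (if i = b * d then Polynomial.C (coeff d φ) * Polynomial.X ^ d else 0) =
      if l = d then (if i = b * d then coeff d φ else 0) else 0 := by
    intro d
    change Polynomial.coeff (if i = b * d then Polynomial.C (coeff d φ) * Polynomial.X ^ d else 0) l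
      = _
    split_ifs <;> simp_all [Polynomial.coeff_C_mul, Polynomial.coeff_X_pow]
  simp only [h3]
  rw [finsum_eq_single _ l (fun d hd => if_neg (Ne.symm hd)), if_pos rfl]

theorem coeff_planeW_coeff_zero (N : ℕ) (hN : N ≠ 0) {n : ℕ} (hn : n ≠ 0) (b : ℕ) (r s : ℂ[X])
    (i : ℕ) : (coeff i (planeW N hN n b r s)).coeff 0 = coeff i (expand N hN (r : ℂ⟦X⟧)) := by
  rw [planeW, map_add, coeff_mul_C, coeff_map, Polynomial.coeff_add, Polynomial.coeff_C_zero,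
    Polynomial.coeff_mul_X_pow', if_neg (by omega), add_zero]

theorem coeff_planeW_coeff_self (N : ℕ) (hN : N ≠ 0) {n : ℕ} (hn : n ≠ 0) (b : ℕ) (r s : ℂ[X])
    (i : ℕ) : (coeff (N * (i + b)) (planeW N hN n b r s)).coeff n = s.coeff i := by
  rw [planeW, map_add, coeff_mul_C, coeff_map, Polynomial.coeff_add,
    Polynomial.coeff_C_of_ne_zero hn, Polynomial.coeff_mul_X_pow', if_pos le_rfl, zero_add,
    Nat.sub_self, mul_add, coeff_mul_X_pow, coeff_map, coeff_expand_mul, Polynomial.coeff_C_zero,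
    Polynomial.coeff_coe]

end PowerSeries

open PowerSeries in
-- Both `r` and `s t^b` have degree less than `c`, so they cannot vanish modulo `t^c` without being
-- zero.
theorem IsStandardForm.eq_zero_of_dvd_planeW {b c : ℕ} {q r s : ℂ[X]} (hα : IsStandardForm b c q r s)
    (N : ℕ) (hN : N ≠ 0) {n : ℕ} (hn : n ≠ 0) (h : X ^ (N * c) ∣ planeW N hN n b r s) :
    r = 0 ∧ s = 0 := by
  rw [X_pow_dvd_iff] at h
  constructor
  · ext i
    by_cases hi : i < c
    · have h1 := coeff_planeW_coeff_zero N hN hn b r s (N * i)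
      rw [h _ (Nat.mul_lt_mul_of_pos_left hi (Nat.pos_of_ne_zero hN)), coeff_expand_mul,
        Polynomial.coeff_coe] at h1
      rw [← h1, Polynomial.coeff_zero, Polynomial.coeff_zero]
    · rw [(Polynomial.degree_lt_iff_coeff_zero _ _).1 hα.degree_r i (by omega),
        Polynomial.coeff_zero]
  · ext i
    by_cases hi : i < c - b
    · have h1 := coeff_planeW_coeff_self N hN hn b r s i
      rw [h _ (Nat.mul_lt_mul_of_pos_left (by omega) (Nat.pos_of_ne_zero hN))] at h1
      rw [← h1, Polynomial.coeff_zero, Polynomial.coeff_zero]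
    · rw [(Polynomial.degree_lt_iff_coeff_zero _ _).1 hα.degree_s i (by omega),
        Polynomial.coeff_zero]

open PowerSeries in
theorem isRankTwoLimit_of_forall_not_dvd {F G : MvPolynomial (Fin 3) ℂ} {d : ℕ}
    (hFd : F.IsHomogeneous d)
    (hp : MvPolynomial.eval ![1, 0, 0] F = 0) {b c : ℕ} {q r s : ℂ[X]}
    (hα : IsStandardForm b c q r s) (hG : IsFlatLimit F (standardGerm b c q r s) G)
    {n : ℕ} (hn : n ≠ 0) (N : ℕ) (hN : N ≠ 0) (φs : Multiset ℂ⟦X⟧) (T : ℂ[X]⟦X⟧)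
    (hT : constantCoeff T = 0) (hT0 : T ≠ 0) (hT' : constantCoeff (map Polynomial.C T) = 0)
    {κ μ : ℂ} {i j : ℕ} (hκ : κ ≠ 0)
    (h : algebraMap ℂ ℂ[X][X] κ * lead (map Polynomial.C T) ^ i * dehom n G =
      algebraMap ℂ ℂ[X][X] μ * lead (map Polynomial.C T) ^ j *
        (φs.map fun φ => lead (coordZ N hN n b c r s -
          substHom (map Polynomial.C T) hT' φ)).prod)
    (hφ : ∀ φ ∈ φs, ¬ X ^ (N * c) ∣ planeW N hN n b r s - substHom T hT φ) :
    IsRankTwoLimit F G := by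
  refine isRankTwoLimit_of_natDegree_dehom_eq_zero hFd hp hα hG n hn ?_
  have hTl : lead (map Polynomial.C T) = Polynomial.C (lead T) := by
    have hc : ∀ i, coeff i (map Polynomial.C T) = Polynomial.C (coeff i T) := fun i => coeff_map _ _ _
    rw [lead_apply T, ← hc]
    refine lead_eq_coeff (fun i hi => ?_) ?_
    · rw [hc i, coeff_of_lt_order_toNat i hi, map_zero]
    · rw [hc, Ne, Polynomial.C_eq_zero]
      exact coeff_order hT0
  have h1 : (φs.map fun φ => lead (coordZ N hN n b c r s -
      substHom (map Polynomial.C T) hT' φ)).prod ∈ (Polynomial.C (R := ℂ[X])).range := by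
    refine Subring.multiset_prod_mem _ _ fun x hx => ?_
    obtain ⟨φ, hφs, rfl⟩ := Multiset.mem_map.1 hx
    rw [coordZ_sub_substHom N hN n b c r s T hT, lead_map_C_add_of_not_dvd (hφ φ hφs)]
    exact ⟨_, rfl⟩
  obtain ⟨p, hp⟩ := h1
  have ha : ∀ x : ℂ, algebraMap ℂ ℂ[X][X] x = Polynomial.C (Polynomial.C x) := fun _ => rfl
  rw [← hp, hTl, ha, ha, ← Polynomial.C_pow, ← Polynomial.C_pow, ← Polynomial.C_mul,
    ← Polynomial.C_mul, ← Polynomial.C_mul] at h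
  have h2 := congrArg Polynomial.natDegree h
  rwa [Polynomial.natDegree_C, Polynomial.natDegree_C_mul] at h2
  exact mul_ne_zero (Polynomial.C_ne_zero.2 hκ) (pow_ne_zero _ (lead_ne_zero hT0))

open PowerSeries in
-- Here `T = X^b y` is an explicit root of `X^(N b) y^N`. If some branch has contact, comparing the
-- coefficients of `y^0` and `y^N` forces `r = 0` and `s = 0`, which is excluded; otherwise the
-- limit is free of `z`.
theorem isRankTwoLimit_of_eq_zero {F G : MvPolynomial (Fin 3) ℂ} (hF : F ≠ 0) {d : ℕ}
    (hFd : F.IsHomogeneous d)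
    (hp : MvPolynomial.eval ![1, 0, 0] F = 0) {b c : ℕ} {r s : ℂ[X]}
    (hα : IsStandardForm b c 0 r s) (hne : ¬ (r = 0 ∧ s = 0))
    (hG : IsFlatLimit F (standardGerm b c 0 r s) G) : IsRankTwoLimit F G := by
  obtain ⟨N, hN, φs, hφ, hprod⟩ := exists_branches hF hFd hα hG
  have hb : b ≠ 0 := by have := hα.one_le; omega
  have hN' := Nat.pos_of_ne_zero hN
  have hT : constantCoeff (X ^ b * C (Polynomial.X : ℂ[X])) = 0 := by simp [hb]
  have hT0 : X ^ b * C (Polynomial.X : ℂ[X]) ≠ 0 := by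
    refine mul_ne_zero (pow_ne_zero _ X_ne_zero) ?_
    rw [Ne, ← map_zero (C (R := ℂ[X])), C_injective.eq_iff]
    exact Polynomial.X_ne_zero
  have hT' : constantCoeff (map Polynomial.C (X ^ b * C (Polynomial.X : ℂ[X]))) = 0 := by
    simp [hb]
  obtain ⟨κ, μ, i, j, hκ, hμ, h⟩ := hprod N hN (map Polynomial.C (X ^ b * C (Polynomial.X : ℂ[X])))
    hT' (by rw [Ne, map_eq_zero_iff _ (map_injective _ Polynomial.C_injective)]; exact hT0)
    (by
      rw [coordY_eq_map, ← map_pow, planeY, mul_pow, ← map_pow]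
      simp [pow_mul, pow_right_comm])
  refine isRankTwoLimit_of_forall_not_dvd hFd hp hα hG hN N hN φs _ hT hT0 hT' hκ h ?_
  intro φ hφs hdvd
  rw [X_pow_dvd_iff] at hdvd
  have hφ0 : coeff 0 φ = 0 := by simpa using (hφ φ hφs).1
  have hr : r = 0 := by
    ext i
    by_cases hi : i < c
    · have h1 := congrArg (fun p => Polynomial.coeff p 0)
        (hdvd (N * i) (Nat.mul_lt_mul_of_pos_left hi hN'))
      simp only [map_sub, Polynomial.coeff_sub, coeff_coeff_substHom_monomial, Polynomial.coeff_zero,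
        coeff_planeW_coeff_zero N hN hN, coeff_expand_mul, Polynomial.coeff_coe, hφ0, ite_self,
        sub_zero] at h1
      rw [h1, Polynomial.coeff_zero]
    · rw [(Polynomial.degree_lt_iff_coeff_zero _ _).1 hα.degree_r i (by omega),
        Polynomial.coeff_zero]
  have hs : s = 0 := by
    ext i
    rcases Nat.eq_zero_or_pos i with rfl | hi0
    · rw [Polynomial.coeff_zero_eq_eval_zero, hα.s_zero, Polynomial.coeff_zero]
    by_cases hi : i < c - b
    · have h1 := congrArg (fun p => Polynomial.coeff p N)
        (hdvd (N * (i + b)) (Nat.mul_lt_mul_of_pos_left (by omega) hN'))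
      simp only [map_sub, Polynomial.coeff_sub, coeff_coeff_substHom_monomial, Polynomial.coeff_zero,
        coeff_planeW_coeff_self N hN hN] at h1
      -- In `φ(X^b y)` the monomial `y^N` occurs only with `X^(b N)`, whereas here the exponent is
      -- `N (i + b)` with `i > 0`; this is where `s(0) = 0` enters.
      rw [if_neg, sub_zero] at h1
      · rw [h1, Polynomial.coeff_zero]
      · rw [mul_comm b N]
        intro h2
        have := Nat.eq_of_mul_eq_mul_left hN' h2
        omega
    · rw [(Polynomial.degree_lt_iff_coeff_zero _ _).1 hα.degree_s i (by omega),
        Polynomial.coeff_zero]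
  exact hne ⟨hr, hs⟩

/-! ### The branch that governs the limit -/

namespace PowerSeries

/-- The evaluation of the coefficients at `y = 0`. -/
noncomputable def evZero : ℂ[X]⟦X⟧ →+* ℂ⟦X⟧ :=
  map (RingHomClass.toRingHom (Polynomial.aeval (R := ℂ) (0 : ℂ)))

@[simp]
theorem evZero_map_C (f : ℂ⟦X⟧) : evZero (map Polynomial.C f) = f := by
  ext i
  simp [evZero]

@[simp]
theorem evZero_X : evZero X = X := by simp [evZero]

@[simp]
theorem evZero_C (p : ℂ[X]) : evZero (C p) = C (p.eval 0) := by
  simp [evZero]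

theorem constantCoeff_evZero (f : ℂ[X]⟦X⟧) :
    constantCoeff (evZero f) = (constantCoeff f).eval 0 := by
  rw [← coeff_zero_eq_constantCoeff_apply, ← coeff_zero_eq_constantCoeff_apply, evZero, coeff_map]
  simp

theorem evZero_substHom (T : ℂ[X]⟦X⟧) (hT : constantCoeff T = 0)
    (hT' : constantCoeff (evZero T) = 0) (f : ℂ⟦X⟧) :
    evZero (substHom T hT f) = substHom (evZero T) hT' f :=
  map_substHom (Polynomial.aeval (R := ℂ) (0 : ℂ)) T hT hT' f

theorem X_pow_dvd_evZero {f : ℂ[X]⟦X⟧} {n : ℕ} (h : X ^ n ∣ f) : X ^ n ∣ evZero f := by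
  simpa using map_dvd evZero h

theorem isUnit_of_constantCoeff_eq_C {g : ℂ[X]⟦X⟧} {κ : ℂ} (hκ : κ ≠ 0)
    (hg : constantCoeff g = Polynomial.C κ) : IsUnit g := by
  rw [isUnit_iff_constantCoeff, hg]
  exact Polynomial.isUnit_C.2 (isUnit_iff_ne_zero.2 hκ)

theorem eq_one_of_pow_eq_one {N : ℕ} (hN : N ≠ 0) {f : ℂ⟦X⟧} (h0 : constantCoeff f = 1)
    (h : f ^ N = 1) : f = 1 := by
  have h1 := geom_sum_mul f N
  rw [h, sub_self, mul_eq_zero] at h1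
  refine sub_eq_zero.1 (h1.resolve_left fun h2 => hN ?_)
  have h3 := congrArg (constantCoeff (R := ℂ)) h2
  simpa [h0] using h3

theorem exists_reparametrization {q : ℂ[X]} (hq : q ≠ 0) (ha : q.natTrailingDegree ≠ 0) {N : ℕ}
    (hN : N ≠ 0) :
    ∃ ν ν₁ : ℂ⟦X⟧, IsUnit ν₁ ∧ ν₁ ^ N = ν ∧ (X * ν) ^ q.natTrailingDegree = (q : ℂ⟦X⟧) ∧
      (q = Polynomial.X ^ q.natTrailingDegree → ν = 1) := by
  set a := q.natTrailingDegree with hadef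
  have hdvd : (X : ℂ⟦X⟧) ^ a ∣ (q : ℂ⟦X⟧) := by
    rw [X_pow_dvd_iff]
    intro i hi
    rw [Polynomial.coeff_coe, Polynomial.coeff_eq_zero_of_lt_natTrailingDegree hi]
  obtain ⟨u, hu⟩ := hdvd
  have hu0 : IsUnit u := by
    rw [isUnit_iff_constantCoeff, isUnit_iff_ne_zero]
    have h1 : coeff a (q : ℂ⟦X⟧) = constantCoeff u := by
      rw [hu, coeff_X_pow_mul', if_pos le_rfl, Nat.sub_self, coeff_zero_eq_constantCoeff_apply]
    rw [← h1, Polynomial.coeff_coe]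
    exact Polynomial.trailingCoeff_nonzero_iff_nonzero.2 hq
  have hν : ∃ ν : ℂ⟦X⟧, IsUnit ν ∧ ν ^ a = u ∧ (q = Polynomial.X ^ a → ν = 1) := by
    -- The `a`-th root of a unit is determined only up to a root of unity. Choosing `1` explicitly
    -- when `q = t^a` is what later gives `M = 1`.
    by_cases hqX : q = Polynomial.X ^ a
    · refine ⟨1, isUnit_one, ?_, fun _ => rfl⟩
      have h1 : (q : ℂ⟦X⟧) = X ^ a := by
        conv_lhs => rw [hqX]
        simp
      rw [h1] at hu
      rw [one_pow]
      exact mul_left_cancel₀ (pow_ne_zero a X_ne_zero) (by rw [mul_one]; exact hu)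
    · obtain ⟨z, hz, hza⟩ := exists_pow_eq_of_isUnit a ha u hu0
      exact ⟨z, hz, hza, fun h => absurd h hqX⟩
  obtain ⟨ν, hνu, hνa, hν1⟩ := hν
  obtain ⟨ν₁, h1, h2⟩ := exists_pow_eq_of_isUnit N hN ν hνu
  exact ⟨ν, ν₁, h1, h2, by rw [mul_pow, hνa, hu], hν1⟩

/-- Factor `q + t^b y = q (1 + t^b y / q)`. As `b > a`, the second factor is `1` plus a series
without constant term and has a binomial root. That root equals `1` at `y = 0`, so `T` there is the
chosen root of `q`. -/
theorem exists_root_planeY {q : ℂ[X]} {a b N : ℕ} (hab : a < b) (hN : N ≠ 0)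
    {ν₁ : ℂ⟦X⟧} (hν : IsUnit ν₁) (hq : (X * ν₁ ^ N) ^ a = (q : ℂ⟦X⟧)) :
    ∃ (T₁ : ℂ[X]⟦X⟧) (κ : ℂ), κ ≠ 0 ∧ constantCoeff T₁ = Polynomial.C κ ∧
      (X ^ a * T₁) ^ N = planeY N hN 1 b q ∧
      evZero (X ^ a * T₁) = (X * expand N hN ν₁) ^ a := by
  obtain ⟨η, hη⟩ : ∃ η : ℂ⟦X⟧, η = expand N hN ν₁ ^ a := ⟨_, rfl⟩
  have hηu : IsUnit η := hη ▸ (hν.map (expand N hN)).pow a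
  obtain ⟨η', hη'⟩ := (hηu.pow N).exists_right_inv
  set w : ℂ[X]⟦X⟧ := X ^ (N * (b - a)) * C (Polynomial.X ^ 1) * map Polynomial.C η' with hw
  have hNb : N * (b - a) ≠ 0 := mul_ne_zero hN (by omega)
  have hw0 : constantCoeff w = 0 := by
    rw [hw, map_mul, map_mul, constantCoeff_X_pow hNb, zero_mul, zero_mul]
  obtain ⟨ω, hω0, hω⟩ := exists_pow_eq_one_add N hN w hw0
  have hη0 : constantCoeff η ≠ 0 := ((isUnit_iff_constantCoeff).1 hηu).ne_zero
  have hωe : evZero ω = 1 := by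
    refine eq_one_of_pow_eq_one hN (by rw [constantCoeff_evZero, hω0, Polynomial.eval_one]) ?_
    rw [← map_pow, hω, map_add, map_one, hw, map_mul, map_mul, evZero_C]
    simp
  refine ⟨map Polynomial.C η * ω, constantCoeff η, hη0, ?_, ?_, ?_⟩
  · rw [map_mul, hω0, mul_one, ← coeff_zero_eq_constantCoeff_apply, coeff_map,
      coeff_zero_eq_constantCoeff_apply]
  · have h1 : expand N hN (q : ℂ⟦X⟧) = X ^ (a * N) * η ^ N := by
      rw [← hq, hη]
      simp only [map_pow, map_mul, expand_X]
      ring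
    have h2 : (X : ℂ[X]⟦X⟧) ^ (N * b) = X ^ (a * N) * X ^ (N * (b - a)) := by
      rw [← pow_add, mul_comm a N, ← mul_add, Nat.add_sub_cancel' hab.le]
    have h3 : map Polynomial.C η ^ N * map Polynomial.C η' = 1 := by
      rw [← map_pow, ← map_mul, hη', map_one]
    rw [planeY, h1, h2, map_mul, map_pow, map_pow, map_X, mul_pow, mul_pow, hω, hw, ← pow_mul]
    linear_combination (X ^ (a * N) * X ^ (N * (b - a)) * C (Polynomial.X ^ 1)) * h3
  · rw [map_mul, map_mul, hωe, mul_one, evZero_map_C, map_pow, evZero_X, hη, mul_pow]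

/-- The lowest coefficient of `T` is a constant, so that of `φ(T)` is free of `y` as well. -/
theorem substHom_eq_X_pow_mul {T T₁ : ℂ[X]⟦X⟧} {a : ℕ} (hT : constantCoeff T = 0)
    (hTT : T = X ^ a * T₁) {κ : ℂ} (hκ : κ ≠ 0) (hT₁ : constantCoeff T₁ = Polynomial.C κ)
    {f : ℂ⟦X⟧} (hf : f ≠ 0) :
    ∃ (g : ℂ[X]⟦X⟧) (k : ℂ), k ≠ 0 ∧ constantCoeff g = Polynomial.C k ∧
      substHom T hT f = X ^ (a * f.order.toNat) * g := by
  obtain ⟨n, u, hfu, hu, hn, hl⟩ := exists_eq_X_pow_mul hf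
  have hn' : f.order.toNat = n := by rw [hn]; rfl
  refine ⟨T₁ ^ n * substHom T hT u, κ ^ n * constantCoeff u,
    mul_ne_zero (pow_ne_zero _ hκ) hu, ?_, ?_⟩
  · rw [map_mul, map_pow, hT₁, constantCoeff_substHom]
    simp
  · rw [hn']
    conv_lhs => rw [hfu]
    have hTn : T ^ n = X ^ (a * n) * T₁ ^ n := by rw [hTT, mul_pow, ← pow_mul]
    rw [map_mul, map_pow, substHom_X, hTn, mul_assoc]

/-- If `E` is free of `y` up to order `m`, so is the lowest coefficient of the factor, whether or
not `z` occurs in it. -/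
theorem lead_mem_range {E : ℂ[X]⟦X⟧} {m : ℕ}
    (h : ∀ i ≤ m, coeff i E ∈ (Polynomial.C (R := ℂ)).range) :
    lead (map Polynomial.C E + X ^ m * C Polynomial.X) ∈
      (Polynomial.mapRingHom (Polynomial.C (R := ℂ))).range := by
  by_cases hm : X ^ m ∣ E
  · obtain ⟨k, hk⟩ := h m le_rfl
    rw [lead_map_C_add_of_dvd hm, ← hk]
    exact ⟨Polynomial.C k + Polynomial.X, by simp⟩
  · have hlt : E.order.toNat < m := by
      by_contra hle
      apply hm
      rw [X_pow_dvd_iff]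
      exact fun i hi => coeff_of_lt_order_toNat i (by omega)
    obtain ⟨k, hk⟩ := h _ hlt.le
    rw [lead_map_C_add_of_not_dvd hm, lead_apply, ← hk]
    exact ⟨Polynomial.C k, by simp⟩

theorem lead_mem_range_of_coeff {E : ℂ[X]⟦X⟧} {m n : ℕ} {k : ℂ} (hk : k ≠ 0) (hnm : n < m)
    (h : ∀ i < n, coeff i E = 0) (hn : coeff n E = Polynomial.C k) :
    lead (map Polynomial.C E + X ^ m * C Polynomial.X) ∈
      (Polynomial.mapRingHom (Polynomial.C (R := ℂ))).range := by
  have hn0 : coeff n E ≠ 0 := by rwa [hn, Ne, Polynomial.C_eq_zero]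
  rw [lead_map_C_add_of_not_dvd fun hd => hn0 (X_pow_dvd_iff.1 hd n hnm), lead_eq_coeff h hn0, hn]
  exact ⟨Polynomial.C k, by simp⟩

theorem coeffDeriv_planeY (N : ℕ) (hN : N ≠ 0) (b : ℕ) (q : ℂ[X]) :
    coeffDeriv (planeY N hN 1 b q) = X ^ (N * b) := by
  rw [planeY, map_add, coeffDeriv_map_C, zero_add, Derivation.leibniz, coeffDeriv_X_pow,
    coeffDeriv_C]
  simp

theorem coeffDeriv_planeW (N : ℕ) (hN : N ≠ 0) (b : ℕ) (r s : ℂ[X]) :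
    coeffDeriv (planeW N hN 1 b r s) =
      map Polynomial.C (expand N hN (s : ℂ⟦X⟧)) * X ^ (N * b) := by
  rw [planeW, map_add, coeffDeriv_map_C, zero_add, Derivation.leibniz, Derivation.leibniz,
    coeffDeriv_X_pow, coeffDeriv_C, coeffDeriv_map_C]
  simp

theorem natCast_isUnit {N : ℕ} (hN : N ≠ 0) : IsUnit (N : ℂ[X]⟦X⟧) :=
  isUnit_of_constantCoeff_eq_C (κ := N) (Nat.cast_ne_zero.2 hN) (by simp)

/-- The derivative with respect to `y` of the part `φ(T)` of a factor of the equation. -/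
theorem X_pow_dvd_coeffDeriv_substHom {T T₁ : ℂ[X]⟦X⟧} {a b N : ℕ} (hT : constantCoeff T = 0)
    (hTT : T = X ^ a * T₁) {κ : ℂ} (hκ : κ ≠ 0) (hT₁ : constantCoeff T₁ = Polynomial.C κ)
    (hN : N ≠ 0) {q : ℂ[X]} (hTN : T ^ N = planeY N hN 1 b q) {φ : ℂ⟦X⟧} (hφ : X ^ (N + 1) ∣ φ) :
    X ^ (N * b + a) ∣ coeffDeriv (substHom T hT φ) := by
  have h1 := coeffDeriv_substHom T hT hN (D := X ^ (N * b)) (by rw [hTN]; exact coeffDeriv_planeY N hN b q) φ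
  have h2 : X ^ (N + 1) ∣ euler φ := by
    rw [X_pow_dvd_iff] at hφ ⊢
    intro m hm
    rw [coeff_euler, hφ m hm, mul_zero]
  -- In the chain rule the left side carries `T^N` and the right side `X^(N b) T^(N+1)`. Cancelling
  -- `X^(a N)` leaves `X^(N b + a)` on the right and a unit factor on the left.
  obtain ⟨g, hg⟩ := h2
  rw [hg, map_mul, map_pow, substHom_X] at h1
  have hV : IsUnit ((N : ℂ[X]⟦X⟧) * T₁ ^ N) :=
    (natCast_isUnit hN).mul ((isUnit_of_constantCoeff_eq_C hκ hT₁).pow N)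
  have h3 : X ^ (a * N) * ((N : ℂ[X]⟦X⟧) * T₁ ^ N * coeffDeriv (substHom T hT φ)) =
      X ^ (a * N) * (X ^ (N * b + a) * (T₁ ^ (N + 1) * substHom T hT g)) := by
    have h4 : T ^ N = X ^ (a * N) * T₁ ^ N := by rw [hTT, mul_pow, ← pow_mul]
    have h5 : T ^ (N + 1) = X ^ (a * N) * X ^ a * T₁ ^ (N + 1) := by
      rw [hTT, mul_pow, ← pow_mul, mul_add, mul_one, pow_add]
    rw [h4, h5] at h1
    rw [pow_add]
    linear_combination h1
  have h6 := mul_left_cancel₀ (pow_ne_zero _ X_ne_zero) h3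
  rw [← hV.dvd_mul_left, h6]
  exact dvd_mul_right _ _

end PowerSeries

open PowerSeries

/-- Some factor must involve `y` and some factor must involve `z`. The first requirement excludes `b
= c` and excludes that the zero branch alone has contact; the second provides a branch with contact.
-/
theorem exists_branch_of_not_isRankTwoLimit {F G : MvPolynomial (Fin 3) ℂ} {d : ℕ}
    (hFd : F.IsHomogeneous d)
    (hp : MvPolynomial.eval ![1, 0, 0] F = 0) {b c : ℕ} {q r s : ℂ[X]}
    (hα : IsStandardForm b c q r s) (hG : IsFlatLimit F (standardGerm b c q r s) G)
    (hG2 : ¬ IsRankTwoLimit F G) (hq : q ≠ 0) {a : ℕ} (ha : q.natTrailingDegree = a) (ha0 : a ≠ 0)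
    (hab : a < b) {N : ℕ} (hN : N ≠ 0) (φs : Multiset ℂ⟦X⟧)
    {T T₁ : ℂ[X]⟦X⟧} (hT : constantCoeff T = 0)
    (hTT : T = X ^ a * T₁) {κ : ℂ} (hκ : κ ≠ 0) (hT₁ : constantCoeff T₁ = Polynomial.C κ)
    (hTN : T ^ N = planeY N hN 1 b q)
    (hT' : constantCoeff (map Polynomial.C T) = 0)
    {k μ : ℂ} {i j : ℕ} (hk : k ≠ 0)
    (h : algebraMap ℂ ℂ[X][X] k * lead (map Polynomial.C T) ^ i * dehom 1 G =
      algebraMap ℂ ℂ[X][X] μ * lead (map Polynomial.C T) ^ j *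
        (φs.map fun φ => lead (coordZ N hN 1 b c r s -
          substHom (map Polynomial.C T) hT' φ)).prod) :
    b < c ∧ ∃ φ ∈ φs, φ ≠ 0 ∧ X ^ (N * c) ∣ planeW N hN 1 b r s - substHom T hT φ := by
  have hT0 : T ≠ 0 := by
    rw [hTT]
    exact mul_ne_zero (pow_ne_zero _ X_ne_zero) (isUnit_of_constantCoeff_eq_C hκ hT₁).ne_zero
  have hN' := Nat.pos_of_ne_zero hN
  have hrange : ¬ ∀ φ ∈ φs, lead (map Polynomial.C (planeW N hN 1 b r s - substHom T hT φ) +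
      X ^ (N * c) * C Polynomial.X) ∈ (Polynomial.mapRingHom (Polynomial.C (R := ℂ))).range := by
    intro hall
    refine hG2 (isRankTwoLimit_of_dehom_mem_range hFd hp hα hG ?_)
    have hTl : lead (map Polynomial.C T) = Polynomial.C (Polynomial.C κ) := by
      have h1 : constantCoeff (map Polynomial.C T₁) = Polynomial.C (Polynomial.C κ) := by
        rw [← hT₁, ← coeff_zero_eq_constantCoeff_apply, coeff_map,
          coeff_zero_eq_constantCoeff_apply]
      rw [hTT, map_mul, map_pow, map_X, lead_X_pow_mul, h1]
      rw [h1]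
      simpa using hκ
    have hmem : ∀ x : ℂ, Polynomial.C (Polynomial.C x) ∈
        (Polynomial.mapRingHom (Polynomial.C (R := ℂ))).range := fun x =>
      ⟨Polynomial.C x, by simp⟩
    have hprod : (φs.map fun φ => lead (coordZ N hN 1 b c r s -
        substHom (map Polynomial.C T) hT' φ)).prod ∈
        (Polynomial.mapRingHom (Polynomial.C (R := ℂ))).range := by
      refine Subring.multiset_prod_mem _ _ fun x hx => ?_
      obtain ⟨φ, hφ, rfl⟩ := Multiset.mem_map.1 hx
      rw [coordZ_sub_substHom N hN 1 b c r s T hT]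
      exact hall φ hφ
    have hC : ∀ x : ℂ, algebraMap ℂ ℂ[X][X] x = Polynomial.C (Polynomial.C x) := fun _ => rfl
    rw [hTl, hC, hC] at h
    have h2 : dehom 1 G = Polynomial.C (Polynomial.C ((k * κ ^ i)⁻¹)) *
        (Polynomial.C (Polynomial.C μ) * Polynomial.C (Polynomial.C κ) ^ j *
        (φs.map fun φ => lead (coordZ N hN 1 b c r s -
          substHom (map Polynomial.C T) hT' φ)).prod) := by
      rw [← h, ← mul_assoc]
      simp only [← map_pow, ← map_mul]
      rw [inv_mul_cancel₀ (mul_ne_zero hk (pow_ne_zero _ hκ))]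
      simp
    rw [h2]
    exact mul_mem (hmem _) (mul_mem (mul_mem (hmem _) (pow_mem (hmem _) _)) hprod)
  -- If `b = c`, then `s = 0` by degree and `r` has order greater than `a`; every factor is shown to
  -- be free of `y`.
  have hbc : b < c := by
    by_contra hbc
    have hbc : b = c := le_antisymm hα.le (not_lt.1 hbc)
    subst hbc
    have hs : s = 0 := by
      have := hα.degree_s
      simpa using this
    have hr : X ^ (a + 1) ∣ (r : ℂ⟦X⟧) := by
      have h1 := hα.order_lt rfl (fun h => hq h.1)
      have h2 : (q : ℂ⟦X⟧).order = a := by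
        refine order_eq_of_coeff (fun i hi => ?_) ?_
        · rw [Polynomial.coeff_coe, Polynomial.coeff_eq_zero_of_lt_natTrailingDegree (by omega)]
        · rw [Polynomial.coeff_coe, ← ha]
          exact Polynomial.trailingCoeff_nonzero_iff_nonzero.2 hq
      rw [h2] at h1
      rw [X_pow_dvd_iff]
      intro i hi
      refine coeff_of_lt_order i (lt_of_le_of_lt ?_ h1)
      exact_mod_cast Nat.lt_succ_iff.1 hi
    have hr' : (X : ℂ⟦X⟧) ^ (N * (a + 1)) ∣ expand N hN (r : ℂ⟦X⟧) := by
      have h1 := map_dvd (expand N hN) hr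
      rwa [map_pow, expand_X, ← pow_mul] at h1
    have hW : planeW N hN 1 b r s = map Polynomial.C (expand N hN (r : ℂ⟦X⟧)) := by
      rw [planeW, hs]; simp
    apply hrange
    intro φ hφ
    rw [hW]
    by_cases hφ0 : φ = 0
    · rw [hφ0, map_zero, sub_zero]
      refine lead_mem_range fun i _ => ?_
      rw [coeff_map]
      exact ⟨_, rfl⟩
    -- A branch of order at most `N` dominates both `r` and `t^b z`, and its lowest coefficient is
    -- constant. A branch of order greater than `N` depends on `y` only from `X^(N b + a)` on,
    -- beyond the order `N b = N c` that matters.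
    by_cases he : φ.order.toNat ≤ N
    · obtain ⟨g, l, hl, hgl, hg⟩ := substHom_eq_X_pow_mul hT hTT hκ hT₁ hφ0
      have hlt : a * φ.order.toNat < N * (a + 1) := by nlinarith
      have hlt' : a * φ.order.toNat < N * b := by nlinarith
      refine lead_mem_range_of_coeff (n := a * φ.order.toNat) (k := -l) (neg_ne_zero.2 hl) hlt'
        (fun i hi => ?_) ?_
      · rw [map_sub, coeff_map, X_pow_dvd_iff.1 hr' i (by omega), map_zero, hg, coeff_X_pow_mul',
          if_neg (by omega), sub_zero]
      · rw [map_sub, coeff_map, X_pow_dvd_iff.1 hr' _ hlt, map_zero, hg, coeff_X_pow_mul',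
          if_pos le_rfl, Nat.sub_self, coeff_zero_eq_constantCoeff_apply, hgl, zero_sub, map_neg]
    · have h1 : X ^ (N + 1) ∣ φ := by
        rw [X_pow_dvd_iff]
        exact fun i hi => coeff_of_lt_order_toNat i (by omega)
      have h2 := X_pow_dvd_coeffDeriv_substHom hT hTT hκ hT₁ hN hTN h1
      refine lead_mem_range fun i hi => ?_
      have h3 : Polynomial.derivative (coeff i
          (map Polynomial.C (expand N hN (r : ℂ⟦X⟧)) - substHom T hT φ)) = 0 := by
        rw [← coeff_coeffDeriv, map_sub, coeffDeriv_map_C, zero_sub, map_neg,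
          X_pow_dvd_iff.1 h2 i (by omega), neg_zero]
      exact ⟨_, (Polynomial.eq_C_of_derivative_eq_zero h3).symm⟩
  refine ⟨hbc, ?_⟩
  by_contra hcon
  push Not at hcon
  have hex : ∃ φ ∈ φs, X ^ (N * c) ∣ planeW N hN 1 b r s - substHom T hT φ := by
    by_contra hno
    push Not at hno
    exact hG2 (isRankTwoLimit_of_forall_not_dvd hFd hp hα hG one_ne_zero N hN φs T hT hT0 hT' hk h
      hno)
  obtain ⟨φ₀, hφ₀, hd⟩ := hex
  have hφ₀0 : φ₀ = 0 := by
    by_contra h0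
    exact hcon φ₀ hφ₀ h0 hd
  rw [hφ₀0, map_zero, sub_zero] at hd
  -- Contact with the zero branch gives `r = s = 0`. Each nonzero branch, having no contact, then
  -- has `φ(T)` of order below `N c` with constant lowest coefficient, so no factor involves `y`.
  obtain ⟨hr, hs⟩ := hα.eq_zero_of_dvd_planeW N hN one_ne_zero hd
  have hW : planeW N hN 1 b r s = 0 := by rw [planeW, hr, hs]; simp
  apply hrange
  intro φ hφ
  rw [hW]
  by_cases hφ0 : φ = 0
  · rw [hφ0, map_zero, sub_zero]
    refine lead_mem_range fun i _ => ?_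
    rw [map_zero]
    exact zero_mem _
  · obtain ⟨g, l, hl, hgl, hg⟩ := substHom_eq_X_pow_mul hT hTT hκ hT₁ hφ0
    have hlt : a * φ.order.toNat < N * c := by
      by_contra hle
      refine hcon φ hφ hφ0 ?_
      rw [hW, zero_sub, hg, dvd_neg]
      exact (pow_dvd_pow X (not_lt.1 hle)).trans (dvd_mul_right _ _)
    refine lead_mem_range_of_coeff (n := a * φ.order.toNat) (k := -l) (neg_ne_zero.2 hl) hlt
      (fun i hi => ?_) ?_
    · rw [zero_sub, map_neg, hg, coeff_X_pow_mul', if_neg (by omega), neg_zero]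
    · rw [zero_sub, map_neg, hg, coeff_X_pow_mul', if_pos le_rfl, Nat.sub_self,
        coeff_zero_eq_constantCoeff_apply, hgl, map_neg]

/-! ### Consequences of the contact with the branch -/

namespace PowerSeries

theorem X_pow_dvd_expand_iff {N : ℕ} (hN : N ≠ 0) (c : ℕ) (f : ℂ⟦X⟧) :
    X ^ (N * c) ∣ expand N hN f ↔ X ^ c ∣ f := by
  rw [X_pow_dvd_iff, X_pow_dvd_iff]
  constructor
  · intro h i hi
    rw [← coeff_expand_mul N hN]
    exact h _ (Nat.mul_lt_mul_of_pos_left hi (Nat.pos_of_ne_zero hN))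
  · intro h i hi
    by_cases hd : N ∣ i
    · obtain ⟨j, rfl⟩ := hd
      rw [coeff_expand_mul]
      exact h j (Nat.lt_of_mul_lt_mul_left hi)
    · exact coeff_expand_of_not_dvd _ _ _ hd

theorem order_substHom {S : ℂ⟦X⟧} (hS : constantCoeff S = 0) (hS0 : S ≠ 0) (f : ℂ⟦X⟧) (hf : f ≠ 0) :
    (substHom S hS f).order = f.order.toNat * S.order :=
  (substHom_ne_zero_and_lead hS0 hS hf).2.1

theorem order_X_mul_isUnit {u : ℂ⟦X⟧} (hu : IsUnit u) : (X * u).order = 1 := by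
  rw [order_mul, order_X, order_zero_of_unit hu, add_zero]

section Contact

variable {T T₁ : ℂ[X]⟦X⟧} {a b c N : ℕ} {κ : ℂ} {q r s : ℂ[X]} {φ ξ : ℂ⟦X⟧}

theorem contact_value (hT : constantCoeff T = 0) (hN : N ≠ 0)
    (hT0 : evZero T = ξ) (hξ : constantCoeff ξ = 0)
    (hd : X ^ (N * c) ∣ planeW N hN 1 b r s - substHom T hT φ) :
    X ^ (N * c) ∣ expand N hN (r : ℂ⟦X⟧) - substHom ξ hξ φ := by
  subst hT0
  have h := X_pow_dvd_evZero hd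
  rw [map_sub, evZero_substHom T hT hξ, planeW, map_add, evZero_map_C, map_mul, evZero_C] at h
  simpa using h

/-- Differentiate the contact in `y`, multiply by `N T^N` and use the chain rule: a factor `X^(N b)`
cancels. The factor `T^N` gives back `X^(N a)`, whence the modulus `N (c - b + a)`; then set `y =
0`. -/
theorem contact_derivative (hT : constantCoeff T = 0) (hN : N ≠ 0)
    (hTT : T = X ^ a * T₁) (hTN : T ^ N = planeY N hN 1 b q)
    (hT0 : evZero T = ξ) (hξ : constantCoeff ξ = 0) (hbc : b < c)
    (hd : X ^ (N * c) ∣ planeW N hN 1 b r s - substHom T hT φ) :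
    X ^ (N * (c - b + a)) ∣
      (N : ℂ⟦X⟧) * ξ ^ N * expand N hN (s : ℂ⟦X⟧) - substHom ξ hξ (euler φ) := by
  subst hT0
  have h1 := X_pow_dvd_coeffDeriv hd
  rw [map_sub, coeffDeriv_planeW] at h1
  have h2 := coeffDeriv_substHom T hT hN (D := X ^ (N * b))
    (by rw [hTN]; exact coeffDeriv_planeY N hN b q) φ
  have h3 : (X : ℂ[X]⟦X⟧) ^ (N * a) ∣ (N : ℂ[X]⟦X⟧) * T ^ N := by
    rw [hTT, mul_pow, ← pow_mul, mul_comm a N]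
    exact (dvd_mul_right _ _).mul_left _
  have h4 := mul_dvd_mul h3 h1
  have h5 : (X : ℂ[X]⟦X⟧) ^ (N * a) * X ^ (N * c) = X ^ (N * b) * X ^ (N * (c - b + a)) := by
    rw [← pow_add, ← pow_add, ← mul_add, ← mul_add]
    congr 2
    omega
  have h6 : (N : ℂ[X]⟦X⟧) * T ^ N * (map Polynomial.C (expand N hN (s : ℂ⟦X⟧)) * X ^ (N * b) -
      coeffDeriv (substHom T hT φ)) = X ^ (N * b) *
        ((N : ℂ[X]⟦X⟧) * T ^ N * map Polynomial.C (expand N hN (s : ℂ⟦X⟧)) - substHom T hT (euler φ)) := by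
    linear_combination - h2
  rw [h5, h6, mul_dvd_mul_iff_left (pow_ne_zero _ X_ne_zero)] at h4
  have h7 := X_pow_dvd_evZero h4
  rw [map_sub, evZero_substHom T hT hξ, map_mul, evZero_map_C] at h7
  simpa using h7

/-- Because `s(0) = 0`, the term `N ξ^N s` vanishes to order greater than `N a`, and so does the
modulus since `b < c`. Hence `(X φ')(ξ)`, of order `a · ord φ`, does too. -/
theorem order_lt_of_contact (hT : constantCoeff T = 0) (hN : N ≠ 0)
    (hTT : T = X ^ a * T₁) (hTN : T ^ N = planeY N hN 1 b q) (hs : s.eval 0 = 0)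
    (hT0 : evZero T = ξ) (hξ : constantCoeff ξ = 0) (hξa : ξ.order = a) (hbc : b < c)
    (hφ : φ ≠ 0) (hφ0 : constantCoeff φ = 0)
    (hd : X ^ (N * c) ∣ planeW N hN 1 b r s - substHom T hT φ) :
    N < φ.order.toNat := by
  have hN' := Nat.pos_of_ne_zero hN
  have h1 := contact_derivative hT hN hTT hTN hT0 hξ hbc hd
  have hs' : (X : ℂ⟦X⟧) ^ N ∣ expand N hN (s : ℂ⟦X⟧) := by
    have h2 := (X_pow_dvd_expand_iff hN 1 (s : ℂ⟦X⟧)).2 (by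
      rw [pow_one, X_dvd_iff, ← coeff_zero_eq_constantCoeff_apply, Polynomial.coeff_coe,
        Polynomial.coeff_zero_eq_eval_zero, hs])
    rwa [mul_one] at h2
  have hξd : (X : ℂ⟦X⟧) ^ a ∣ ξ := by
    rw [X_pow_dvd_iff]
    exact fun i hi => coeff_of_lt_order i (by rw [hξa]; exact_mod_cast hi)
  have hξ0 : ξ ≠ 0 := by
    intro h0
    rw [h0, order_zero] at hξa
    exact ENat.top_ne_natCast _ hξa
  have h2 : (X : ℂ⟦X⟧) ^ (N * a + 1) ∣ (N : ℂ⟦X⟧) * ξ ^ N * expand N hN (s : ℂ⟦X⟧) := by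
    have h3 := mul_dvd_mul ((pow_dvd_pow_of_dvd hξd N).mul_left (N : ℂ⟦X⟧)) hs'
    rw [← pow_mul, ← pow_add] at h3
    exact (pow_dvd_pow X (by nlinarith)).trans h3
  have h3 : (X : ℂ⟦X⟧) ^ (N * a + 1) ∣ substHom ξ hξ (euler φ) := by
    have h4 : (X : ℂ⟦X⟧) ^ (N * a + 1) ∣ X ^ (N * (c - b + a)) := by
      refine pow_dvd_pow X ?_
      rw [mul_add]
      have : N * 1 ≤ N * (c - b) := Nat.mul_le_mul_left N (by omega)
      omega
    have h5 := dvd_sub h2 (h4.trans h1)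
    rwa [sub_sub_cancel] at h5
  have heo := order_euler hφ0
  have he0 : euler φ ≠ 0 := by
    intro h0
    rw [h0, order_zero] at heo
    exact hφ (order_eq_top.1 heo.symm)
  have h4 := order_substHom hξ hξ0 _ he0
  rw [heo, hξa] at h4
  by_contra hle
  have h5 : (φ.order.toNat : ℕ∞) * a = ((φ.order.toNat * a : ℕ) : ℕ∞) := by push_cast; rfl
  rw [h5] at h4
  exact (order_eq_nat.1 h4).1 (X_pow_dvd_iff.1 h3 _ (by nlinarith))

/-- The second `y`-derivative kills `r + s t^b y`, so that of `φ(T)` is divisible by `X^(N c)`. The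
second-order chain rule computes its order exactly, because the lowest coefficient of `E(E - N) φ`
is multiplied by `k (k - N)` with `k = ord φ > N`. -/
theorem contact_inequality (hT : constantCoeff T = 0) (hN : N ≠ 0)
    (hTT : T = X ^ a * T₁) (hκ : κ ≠ 0) (hT₁ : constantCoeff T₁ = Polynomial.C κ)
    (hTN : T ^ N = planeY N hN 1 b q) (hφ : N < φ.order.toNat) (hφ0 : φ ≠ 0)
    (hd : X ^ (N * c) ∣ planeW N hN 1 b r s - substHom T hT φ) :
    N * c + 2 * (N * a) ≤ 2 * (N * b) + a * φ.order.toNat := by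
  have h1 := X_pow_dvd_coeffDeriv (X_pow_dvd_coeffDeriv hd)
  have h2 : coeffDeriv (coeffDeriv (planeW N hN 1 b r s)) = 0 := by
    rw [coeffDeriv_planeW, Derivation.leibniz, coeffDeriv_X_pow, coeffDeriv_map_C]
    simp
  rw [map_sub, map_sub, h2, zero_sub, dvd_neg] at h1
  have h3 := coeffDeriv_coeffDeriv_substHom T hT hN (D := X ^ (N * b))
    (by rw [hTN]; exact coeffDeriv_planeY N hN b q) (coeffDeriv_X_pow _) φ
  set g := euler (euler φ) - (N : ℂ⟦X⟧) * euler φ with hg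
  have hgc : ∀ i, coeff i g = ((i : ℂ) * (i - N)) * coeff i φ := by
    intro i
    rw [hg, map_sub, coeff_euler, ← map_natCast (C (R := ℂ)), coeff_C_mul, coeff_euler]
    ring
  have hgo : g.order = φ.order.toNat := by
    refine order_eq_of_coeff (fun i hi => ?_) ?_
    · rw [hgc, coeff_of_lt_order_toNat i hi, mul_zero]
    · rw [hgc]
      refine mul_ne_zero (mul_ne_zero (Nat.cast_ne_zero.2 (by omega)) (sub_ne_zero.2 ?_))
        (coeff_order hφ0)
      exact_mod_cast hφ.ne'
  have hg0 : g ≠ 0 := by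
    intro h0
    rw [h0, order_zero] at hgo
    exact ENat.top_ne_natCast _ hgo
  obtain ⟨u, k, hk, huk, hu⟩ := substHom_eq_X_pow_mul hT hTT hκ hT₁ hg0
  have hgo' : g.order.toNat = φ.order.toNat := by rw [hgo]; rfl
  have h4 : (X : ℂ[X]⟦X⟧) ^ (2 * (N * a) + N * c) ∣ X ^ (2 * (N * b) + a * φ.order.toNat) * u := by
    have h5 : (X : ℂ[X]⟦X⟧) ^ (2 * (N * a)) ∣ (N : ℂ[X]⟦X⟧) ^ 2 * (T ^ N) ^ 2 := by
      refine Dvd.dvd.mul_left ⟨(T₁ ^ N) ^ 2, ?_⟩ _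
      rw [hTT]
      ring
    have h6 := mul_dvd_mul h5 h1
    rw [h3, hu, hgo', ← pow_add] at h6
    convert h6 using 1
    ring
  have hunit := isUnit_of_constantCoeff_eq_C hk huk
  rw [hunit.dvd_mul_right] at h4
  have h7 := (pow_dvd_pow_iff (X_ne_zero) (X_prime (R := ℂ[X])).not_isUnit).1 h4
  omega

end Contact

/-- Undoing a reparametrization `X ↦ X * expand N ν₁` in a congruence. -/
theorem exists_truncation {N : ℕ} (hN : N ≠ 0) (c : ℕ) {ν₁ : ℂ⟦X⟧} (hν : IsUnit ν₁)
    (hξ : constantCoeff (X * expand N hN ν₁) = 0) (hχ : constantCoeff (X * ν₁ ^ N) = 0)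
    (g ψ : ℂ⟦X⟧)
    (h : X ^ (N * c) ∣ expand N hN g - substHom (X * expand N hN ν₁) hξ ψ) :
    ∃ ρ : ℂ[X], ρ.degree < (c : ℕ) ∧ X ^ (N * c) ∣ expand N hN (ρ : ℂ⟦X⟧) - ψ ∧
      X ^ c ∣ substHom (X * ν₁ ^ N) hχ (ρ : ℂ⟦X⟧) - g := by
  set ξ := X * expand N hN ν₁ with hξdef
  have hξN : ξ ^ N = expand N hN (X * ν₁ ^ N) := by
    rw [hξdef, mul_pow, map_mul, map_pow, expand_X]
  have hcomp : ∀ f : ℂ⟦X⟧, substHom ξ hξ (expand N hN f) =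
      expand N hN (substHom (X * ν₁ ^ N) hχ f) := by
    intro f
    rw [substHom_expand, expand_substHom]
    exact substHom_congr hξN _ _ _
  have hξo : ξ.order = 1 := order_X_mul_isUnit (hν.map (expand N hN))
  have hξ0 : ξ ≠ 0 := by
    intro h0
    rw [h0, order_zero] at hξo
    exact ENat.top_ne_one hξo
  set ψ₁ : ℂ⟦X⟧ := mk fun i => coeff (N * i) ψ with hψ₁
  -- Below `N c` all exponents of `ψ` are multiples of `N`. Composition with `ξ`, which is `X` times
  -- a series in `X^N`, keeps series in `X^N` such, and the first other exponent of `ψ` survives it,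
  -- contradicting the congruence.
  have hψ₂ : X ^ (N * c) ∣ expand N hN ψ₁ - ψ := by
    by_cases h0 : expand N hN ψ₁ - ψ = 0
    · rw [h0]; exact dvd_zero _
    set n := (expand N hN ψ₁ - ψ).order.toNat with hn
    have hnc := coeff_order h0
    rw [← hn] at hnc
    have hnd : ¬ N ∣ n := by
      rintro ⟨j, hj⟩
      rw [hj, map_sub, coeff_expand_mul, hψ₁, coeff_mk, sub_self] at hnc
      exact hnc rfl
    have hle : N * c ≤ n := by
      by_contra hlt
      rw [not_le] at hlt
      have h1 := order_substHom hξ hξ0 _ h0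
      rw [hξo, mul_one, ← hn] at h1
      apply (order_eq_nat.1 h1).1
      have h2 := X_pow_dvd_iff.1 h n hlt
      rw [map_sub, coeff_expand_of_not_dvd _ _ _ hnd, zero_sub, neg_eq_zero] at h2
      rw [map_sub, map_sub, h2, hcomp, coeff_expand_of_not_dvd _ _ _ hnd, sub_zero]
    rw [X_pow_dvd_iff]
    exact fun i hi => coeff_of_lt_order_toNat i (by omega)
  have htrunc : X ^ c ∣ ((trunc c ψ₁ : ℂ[X]) : ℂ⟦X⟧) - ψ₁ := by
    rw [X_pow_dvd_iff]
    intro i hi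
    rw [map_sub, Polynomial.coeff_coe, coeff_trunc, if_pos hi, sub_self]
  have hρ : X ^ (N * c) ∣ expand N hN ((trunc c ψ₁ : ℂ[X]) : ℂ⟦X⟧) - ψ := by
    have h1 := (X_pow_dvd_expand_iff hN c _).2 htrunc
    rw [map_sub] at h1
    have h2 := dvd_add h1 hψ₂
    rwa [sub_add_sub_cancel] at h2
  refine ⟨trunc c ψ₁, degree_trunc_lt _ _, hρ, ?_⟩
  rw [← X_pow_dvd_expand_iff hN, map_sub, ← hcomp]
  have h3 := X_pow_dvd_substHom ξ hξ hρ
  rw [map_sub] at h3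
  have h4 := dvd_sub h3 h
  rwa [sub_sub_sub_cancel_right] at h4

end PowerSeries

/-! ### Series with fractional exponents -/

namespace PowerSeries

variable (N : ℕ)

/-- The series `∑ φ_k y ^ (k / N)` attached to `∑ φ_k X ^ k`. -/
noncomputable def toPuiseux (hN : N ≠ 0) : ℂ⟦X⟧ →+* HahnSeries ℚ ℂ :=
  (HahnSeries.embDomainRingHom (AddMonoidHom.mulLeft ((N : ℚ)⁻¹))
    (mul_right_injective₀ (inv_ne_zero (Nat.cast_ne_zero.2 hN)))
    (fun _ _ => mul_le_mul_iff_right₀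
      (inv_pos.2 (Nat.cast_pos.2 (Nat.pos_of_ne_zero hN))))).comp
    (HahnSeries.ofPowerSeries ℚ ℂ)

variable {N} (hN : N ≠ 0)

theorem coeff_ofPowerSeries_of_forall_ne {f : ℂ⟦X⟧} {l : ℚ} (h : ∀ k : ℕ, l ≠ k) :
    (HahnSeries.ofPowerSeries ℚ ℂ f).coeff l = 0 := by
  rw [HahnSeries.ofPowerSeries_apply]
  refine HahnSeries.embDomain_of_notMem_range ?_
  rintro ⟨k, hk⟩
  exact h k hk.symm

theorem coeff_toPuiseux (f : ℂ⟦X⟧) (l : ℚ) :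
    (toPuiseux N hN f).coeff l = (HahnSeries.ofPowerSeries ℚ ℂ f).coeff (N * l) := by
  have hN' : (N : ℚ) ≠ 0 := Nat.cast_ne_zero.2 hN
  have hl : l = (N : ℚ)⁻¹ * (N * l) := by rw [inv_mul_cancel_left₀ hN']
  conv_lhs => rw [hl]
  exact HahnSeries.embDomain_mk_coeff _ _

theorem coeff_toPuiseux_of_eq {f : ℂ⟦X⟧} {l : ℚ} {k : ℕ} (h : N * l = k) :
    (toPuiseux N hN f).coeff l = coeff k f := by
  rw [coeff_toPuiseux, h, HahnSeries.ofPowerSeries_apply_coeff]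

theorem coeff_toPuiseux_of_forall_ne {f : ℂ⟦X⟧} {l : ℚ} (h : ∀ k : ℕ, N * l ≠ k) :
    (toPuiseux N hN f).coeff l = 0 := by
  rw [coeff_toPuiseux, coeff_ofPowerSeries_of_forall_ne h]

theorem exists_of_coeff_toPuiseux_ne_zero {f : ℂ⟦X⟧} {l : ℚ}
    (h : (toPuiseux N hN f).coeff l ≠ 0) : ∃ k : ℕ, N * l = k ∧ coeff k f ≠ 0 := by
  by_contra hcon
  push Not at hcon
  by_cases hk : ∃ k : ℕ, N * l = k
  · obtain ⟨k, hk⟩ := hk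
    exact h (by rw [coeff_toPuiseux_of_eq hN hk, hcon k hk])
  · push Not at hk
    exact h (coeff_toPuiseux_of_forall_ne hN hk)

theorem toPuiseux_C (a : ℂ) : toPuiseux N hN (C a) = HahnSeries.C a := by
  rw [toPuiseux, RingHom.comp_apply, HahnSeries.ofPowerSeries_C]
  exact HahnSeries.embDomainRingHom_C

theorem toPuiseux_X_pow (k : ℕ) :
    toPuiseux N hN (X ^ k) = HahnSeries.single ((k : ℚ) / N) 1 := by
  rw [toPuiseux, RingHom.comp_apply, HahnSeries.ofPowerSeries_X_pow]
  refine HahnSeries.embDomain_single.trans ?_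
  congr 1
  simp [div_eq_inv_mul]

theorem isPuiseux_toPuiseux (f : ℂ⟦X⟧) : IsPuiseux (toPuiseux N hN f) := by
  refine ⟨N, Nat.pos_of_ne_zero hN, fun l hl => ?_⟩
  obtain ⟨k, hk, -⟩ := exists_of_coeff_toPuiseux_ne_zero hN hl
  exact ⟨k, hk⟩

theorem toPuiseux_ne_zero {f : ℂ⟦X⟧} (hf : f ≠ 0) : toPuiseux N hN f ≠ 0 := by
  intro h
  apply coeff_order hf
  have hN' : (N : ℚ) ≠ 0 := Nat.cast_ne_zero.2 hN
  rw [← coeff_toPuiseux_of_eq hN (l := (f.order.toNat : ℚ) / N) (by field_simp), h,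
    HahnSeries.coeff_zero]

theorem order_toPuiseux {f : ℂ⟦X⟧} (hf : f ≠ 0) :
    (toPuiseux N hN f).order = (f.order.toNat : ℚ) / N := by
  have hN' : (N : ℚ) ≠ 0 := Nat.cast_ne_zero.2 hN
  refine le_antisymm (HahnSeries.order_le_of_coeff_ne_zero ?_) ?_
  · rw [coeff_toPuiseux_of_eq hN (k := f.order.toNat) (by field_simp)]
    exact coeff_order hf
  · obtain ⟨k, hk, hk0⟩ := exists_of_coeff_toPuiseux_ne_zero hN
      (mt HahnSeries.coeff_order_eq_zero.1 (toPuiseux_ne_zero hN hf))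
    have h1 : f.order.toNat ≤ k := by
      by_contra hlt
      exact hk0 (coeff_of_lt_order_toNat k (not_le.1 hlt))
    rw [div_le_iff₀ (Nat.cast_pos.2 (Nat.pos_of_ne_zero hN)), mul_comm, hk]
    exact_mod_cast h1

theorem isFormalBranch_toPuiseux {F : MvPolynomial (Fin 3) ℂ} {φ : ℂ⟦X⟧}
    (h : MvPolynomial.aeval ![1, (X : ℂ⟦X⟧) ^ N, φ] F = 0) (hφ : N < φ.order.toNat) :
    IsFormalBranch F (toPuiseux N hN φ) := by
  have hN' : (0 : ℚ) < N := Nat.cast_pos.2 (Nat.pos_of_ne_zero hN)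
  refine ⟨isPuiseux_toPuiseux hN φ, fun l hl => ?_, ?_⟩
  · obtain ⟨k, hk, hk0⟩ := exists_of_coeff_toPuiseux_ne_zero hN hl
    have h1 : N ≤ k := by
      by_contra hlt
      exact hk0 (coeff_of_lt_order_toNat k (by omega))
    have h2 : (N : ℚ) * 1 ≤ N * l := by rw [hk, mul_one]; exact_mod_cast h1
    exact le_of_mul_le_mul_left h2 hN'
  · have h1 : (toPuiseux N hN).comp
        ((MvPolynomial.aeval ![1, (X : ℂ⟦X⟧) ^ N, φ] :
          MvPolynomial (Fin 3) ℂ →ₐ[ℂ] ℂ⟦X⟧) : MvPolynomial (Fin 3) ℂ →+* ℂ⟦X⟧) =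
        ((MvPolynomial.aeval ![1, HahnSeries.single (1 : ℚ) (1 : ℂ), toPuiseux N hN φ] :
          MvPolynomial (Fin 3) ℂ →ₐ[ℂ] HahnSeries ℚ ℂ) :
            MvPolynomial (Fin 3) ℂ →+* HahnSeries ℚ ℂ) := by
      apply MvPolynomial.ringHom_ext
      · intro a
        rw [RingHom.comp_apply, RingHom.coe_coe, RingHom.coe_coe, MvPolynomial.aeval_C,
          MvPolynomial.aeval_C]
        rw [HahnSeries.algebraMap_apply', algebraMap_apply, Algebra.algebraMap_self_apply,
          HahnSeries.ofPowerSeries_C]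
        exact toPuiseux_C hN a
      · intro i
        have h2 := toPuiseux_X_pow hN N
        rw [div_self hN'.ne'] at h2
        fin_cases i
        · simp
        · simpa using h2
        · simp
    have h2 := DFunLike.congr_fun h1 F
    simp only [RingHom.comp_apply, RingHom.coe_coe] at h2
    rw [← h2, h, map_zero]

theorem isTruncation_toPuiseux {c : ℕ} {ρ : ℂ[X]} {ψ : ℂ⟦X⟧} (hρ : ρ.degree < (c : ℕ))
    (h : X ^ (N * c) ∣ expand N hN (ρ : ℂ⟦X⟧) - ψ) : IsTruncation c (toPuiseux N hN ψ) ρ := by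
  have hN' : (0 : ℚ) < N := Nat.cast_pos.2 (Nat.pos_of_ne_zero hN)
  have h1 : HahnSeries.ofPowerSeries ℚ ℂ (ρ : ℂ⟦X⟧) =
      toPuiseux N hN (expand N hN (ρ : ℂ⟦X⟧)) := by
    ext l
    by_cases hk : ∃ k : ℕ, N * l = k
    · obtain ⟨k, hk⟩ := hk
      rw [coeff_toPuiseux_of_eq hN hk]
      by_cases hd : N ∣ k
      · obtain ⟨j, rfl⟩ := hd
        have hl : l = j := by
          push_cast at hk
          exact mul_left_cancel₀ hN'.ne' hk
        rw [coeff_expand_mul, hl, HahnSeries.ofPowerSeries_apply_coeff]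
      · rw [coeff_expand_of_not_dvd _ _ _ hd, coeff_ofPowerSeries_of_forall_ne]
        rintro j rfl
        exact hd ⟨j, by exact_mod_cast hk.symm⟩
    · push Not at hk
      rw [coeff_toPuiseux_of_forall_ne hN hk, coeff_ofPowerSeries_of_forall_ne]
      rintro j rfl
      exact hk (N * j) (by push_cast; rfl)
  rw [IsTruncation, h1]
  ext l
  rw [HahnSeries.coeff_truncLT]
  by_cases hk : ∃ k : ℕ, N * l = k
  · obtain ⟨k, hk⟩ := hk
    rw [coeff_toPuiseux_of_eq hN hk, coeff_toPuiseux_of_eq hN hk]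
    have hlc : l < c ↔ k < N * c := by
      rw [← mul_lt_mul_iff_right₀ hN', hk]
      exact_mod_cast Iff.rfl
    by_cases hkc : k < N * c
    · rw [if_pos (hlc.2 hkc)]
      have h2 := X_pow_dvd_iff.1 h k hkc
      rwa [map_sub, sub_eq_zero] at h2
    · rw [if_neg (mt hlc.1 hkc)]
      by_cases hd : N ∣ k
      · obtain ⟨j, rfl⟩ := hd
        rw [coeff_expand_mul, Polynomial.coeff_coe]
        refine (Polynomial.degree_lt_iff_coeff_zero _ _).1 hρ j ?_
        exact le_of_mul_le_mul_left (not_lt.1 hkc) (Nat.pos_of_ne_zero hN)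
      · exact coeff_expand_of_not_dvd _ _ _ hd
  · push Not at hk
    rw [coeff_toPuiseux_of_forall_ne hN hk, coeff_toPuiseux_of_forall_ne hN hk, ite_self]

theorem coeff_substPow (a : ℕ) (ha : 0 < a) (f : HahnSeries ℚ ℂ) (l : ℚ) :
    (substPow a ha f).coeff l = f.coeff (l / a) := by
  have ha' : (a : ℚ) ≠ 0 := Nat.cast_ne_zero.2 ha.ne'
  have hl : l = (a : ℚ) * (l / a) := by field_simp
  conv_lhs => rw [hl]
  exact HahnSeries.embDomain_coeff (f := OrderEmbedding.ofStrictMono (fun l : ℚ => (a : ℚ) * l)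
    (fun _ _ h => mul_lt_mul_of_pos_left h (Nat.cast_pos.mpr ha)))

theorem substPow_toPuiseux (a : ℕ) (ha : 0 < a) (f : ℂ⟦X⟧) :
    substPow a ha (toPuiseux N hN f) = toPuiseux N hN (expand a ha.ne' f) := by
  have ha' : (a : ℚ) ≠ 0 := Nat.cast_ne_zero.2 ha.ne'
  ext l
  rw [coeff_substPow]
  by_cases hk : ∃ k : ℕ, N * l = k
  · obtain ⟨k, hk⟩ := hk
    rw [coeff_toPuiseux_of_eq hN hk]
    by_cases hd : a ∣ k
    · obtain ⟨j, rfl⟩ := hd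
      rw [coeff_expand_mul, coeff_toPuiseux_of_eq hN]
      rw [mul_div_assoc', hk]
      push_cast
      field_simp
    · rw [coeff_expand_of_not_dvd _ _ _ hd, coeff_toPuiseux_of_forall_ne hN]
      intro j hj
      rw [mul_div_assoc', hk, div_eq_iff ha'] at hj
      exact hd ⟨j, by rw [mul_comm]; exact_mod_cast hj⟩
  · push Not at hk
    rw [coeff_toPuiseux_of_forall_ne hN hk, coeff_toPuiseux_of_forall_ne hN]
    intro j hj
    rw [mul_div_assoc', div_eq_iff ha'] at hj
    exact hk (j * a) (by push_cast; exact hj)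

theorem eulerDeriv_toPuiseux (f : ℂ⟦X⟧) :
    eulerDeriv (toPuiseux N hN f) = toPuiseux N hN (C ((N : ℂ)⁻¹) * euler f) := by
  have hN' : (N : ℂ) ≠ 0 := Nat.cast_ne_zero.2 hN
  ext l
  change (l : ℂ) * (toPuiseux N hN f).coeff l = _
  by_cases hk : ∃ k : ℕ, N * l = k
  · obtain ⟨k, hk⟩ := hk
    rw [coeff_toPuiseux_of_eq hN hk, coeff_toPuiseux_of_eq hN hk, coeff_C_mul, coeff_euler]
    have h1 : (N : ℂ) * (l : ℂ) = k := by exact_mod_cast congrArg (Rat.cast (K := ℂ)) hk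
    rw [← h1]
    field_simp
  · push Not at hk
    rw [coeff_toPuiseux_of_forall_ne hN hk, coeff_toPuiseux_of_forall_ne hN hk, mul_zero]

/-- Written as `(y f')(t^a) t^(b-a)` with `a ≤ b`, the series avoids the negative exponent hidden in
`f'`. -/
theorem substPow_fracDeriv_mul (a b : ℕ) (ha : 0 < a) (hab : a ≤ b) (f : ℂ⟦X⟧) :
    substPow a ha (fracDeriv (toPuiseux N hN f)) * HahnSeries.single (b : ℚ) (1 : ℂ) =
      toPuiseux N hN (X ^ (N * (b - a)) * expand a ha.ne' (C ((N : ℂ)⁻¹) * euler f)) := by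
  have ha' : (a : ℚ) ≠ 0 := Nat.cast_ne_zero.2 ha.ne'
  have hN' : (N : ℚ) ≠ 0 := Nat.cast_ne_zero.2 hN
  rw [map_mul, toPuiseux_X_pow, ← substPow_toPuiseux hN a ha, ← eulerDeriv_toPuiseux]
  ext l
  rw [HahnSeries.coeff_mul_single, coeff_substPow, fracDeriv, HahnSeries.coeff_single_mul,
    HahnSeries.coeff_single_mul, coeff_substPow, mul_one, one_mul, one_mul]
  congr 1
  push_cast [hab]
  field_simp
  ring

end PowerSeries

/-! ### Equivalence with the germ of a branch -/

namespace PowerSeries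

theorem substHom_coe_X {k : Type*} [CommRing k] (h : constantCoeff (X : k⟦X⟧) = 0) (f : k⟦X⟧) :
    substHom X h f = f := by
  rw [substHom_apply, ← map_algebraMap_eq_subst_X]
  simp

theorem coe_eq_coe_of_X_pow_dvd {c : ℕ} {p p' : ℂ[X]} (hp : p.degree < (c : ℕ))
    (hp' : p'.degree < (c : ℕ)) (h : X ^ c ∣ (p : ℂ⟦X⟧) - (p' : ℂ⟦X⟧)) : (p : ℂ⟦X⟧) = p' := by
  ext i
  rcases lt_or_ge i c with hi | hi
  · have h1 := X_pow_dvd_iff.1 h i hi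
    rwa [map_sub, sub_eq_zero] at h1
  · rw [Polynomial.coeff_coe, Polynomial.coeff_coe,
      (Polynomial.degree_lt_iff_coeff_zero _ _).1 hp i hi,
      (Polynomial.degree_lt_iff_coeff_zero _ _).1 hp' i hi]

theorem degree_mul_X_pow_lt {s : ℂ[X]} {b c : ℕ} (hbc : b ≤ c)
    (hs : s.degree < ((c - b : ℕ) : WithBot ℕ)) :
    (s * Polynomial.X ^ b).degree < (c : WithBot ℕ) := by
  rw [Polynomial.degree_lt_iff_coeff_zero] at hs ⊢
  intro m hm
  rw [Polynomial.coeff_mul_X_pow', if_pos (by omega)]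
  exact hs _ (by omega)

end PowerSeries

open PowerSeries

/-- The congruences say that the branch germ at `tν` equals `α n` with `n` lower triangular and
invertible at `0`. Taking `M = n(0)⁻¹` normalizes the change of coordinates to the identity at `0`.
-/
theorem exists_germEquiv_branchGerm {a b c : ℕ} {q r s ρ σ : ℂ[X]} {ν : ℂ⟦X⟧} (hν : IsUnit ν)
    (hχ : constantCoeff (X * ν) = 0) (hq : (X * ν) ^ a = (q : ℂ⟦X⟧))
    (hρ : X ^ c ∣ substHom (X * ν) hχ (ρ : ℂ⟦X⟧) - (r : ℂ⟦X⟧))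
    (hσ : X ^ c ∣ substHom (X * ν) hχ (σ : ℂ⟦X⟧) - (s : ℂ⟦X⟧) * (X * ν) ^ b) :
    ∃ M : Matrix (Fin 3) (Fin 3) ℂ, IsUnit M.det ∧
      (ν = 1 → (ρ : ℂ⟦X⟧) = r → (σ : ℂ⟦X⟧) = (s : ℂ⟦X⟧) * X ^ b → M = 1) ∧
      GermEquiv (standardGerm b c q r s) (branchGerm a b c ρ σ * M.map (C (R := ℂ))) := by
  obtain ⟨u, hu⟩ := hρ
  obtain ⟨v, hv⟩ := hσ
  set n : Matrix (Fin 3) (Fin 3) ℂ⟦X⟧ := !![1, 0, 0; 0, ν ^ b, 0; u, v, ν ^ c] with hn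
  have hprod : (branchGerm a b c ρ σ).map (substHom (X * ν) hχ) = standardGerm b c q r s * n := by
    rw [sub_eq_iff_eq_add] at hu hv
    ext1 i j
    fin_cases i <;> fin_cases j <;>
      simp [branchGerm, standardGerm, hn, Matrix.mul_apply, Fin.sum_univ_three, hu, hv, ← hq] <;>
      ring
  set n₀ : Matrix (Fin 3) (Fin 3) ℂ := n.map (constantCoeff (R := ℂ)) with hn₀
  have hdet : IsUnit n₀.det := by
    have h1 : n.det = ν ^ b * ν ^ c := by simp [hn, Matrix.det_fin_three]
    have h2 : n₀.det = constantCoeff n.det := by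
      rw [hn₀, RingHom.map_det]; rfl
    rw [h2, h1]
    exact ((hν.pow b).mul (hν.pow c)).map _
  refine ⟨n₀⁻¹, ?_, ?_, ν, 1, n * n₀⁻¹.map (C (R := ℂ)), hν, isUnit_one, ?_, ?_⟩
  · exact (Matrix.isUnit_nonsing_inv_det_iff).2 hdet
  · rintro rfl h1 h2
    have hX : (X : ℂ⟦X⟧) ^ c ≠ 0 := pow_ne_zero _ X_ne_zero
    have h3 : ∀ f : ℂ⟦X⟧, substHom (X * 1) hχ f = f := fun f =>
      (substHom_congr (mul_one X) _ constantCoeff_X f).trans (substHom_coe_X _ f)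
    rw [h3, h1, sub_self, eq_comm, mul_eq_zero, or_iff_right hX] at hu
    rw [h3, h2, mul_one, sub_self, eq_comm, mul_eq_zero, or_iff_right hX] at hv
    have h4 : n₀ = 1 := by
      ext1 i j
      fin_cases i <;> fin_cases j <;> simp [hn₀, hn, hu, hv]
    rw [h4, inv_one]
  · rw [Matrix.map_mul, Matrix.map_map]
    have h1 : (n₀⁻¹).map (constantCoeff (R := ℂ) ∘ C (R := ℂ)) = n₀⁻¹ := by
      ext i j
      simp
    rw [h1]
    exact Matrix.mul_nonsing_inv _ hdet
  · have h1 : subst (X * ν) = ⇑(substHom (k := ℂ) (X * ν) hχ) :=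
      funext fun f => (substHom_apply _ hχ f).symm
    have h2 : (n₀⁻¹.map (C (R := ℂ))).map (substHom (X * ν) hχ) = n₀⁻¹.map (C (R := ℂ)) := by
      ext1 i j
      simp
    rw [one_smul, h1, Matrix.map_mul, h2, hprod, Matrix.mul_assoc]

theorem proposition4p1 (d : ℕ) (F : MvPolynomial (Fin 3) ℂ) (hF : F ≠ 0)
    (hFd : F.IsHomogeneous d) (hp : MvPolynomial.eval ![1, 0, 0] F = 0)
    (b c : ℕ) (q r s : ℂ[X]) (hα : IsStandardForm b c q r s)
    (hne : ¬ (q = 0 ∧ r = 0 ∧ s = 0))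
    (G : MvPolynomial (Fin 3) ℂ) (hG : IsFlatLimit F (standardGerm b c q r s) G)
    (hG2 : ¬ IsRankTwoLimit F G) :
    ∃ (f : HahnSeries ℚ ℂ) (a : ℕ) (ha : 0 < a) (ρ σ : ℂ[X]) (M : Matrix (Fin 3) (Fin 3) ℂ),
      IsFormalBranch F f ∧ f ≠ 0 ∧ 1 < f.order ∧
      q ≠ 0 ∧ q.natTrailingDegree = a ∧ a < b ∧ b < c ∧
      IsTruncation c (substPow a ha f) ρ ∧
      IsTruncation c
        (substPow a ha (fracDeriv f) * HahnSeries.single (b : ℚ) (1 : ℂ)) σ ∧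
      IsUnit M.det ∧ (q = Polynomial.X ^ a → M = 1) ∧
      GermEquiv (standardGerm b c q r s)
        (branchGerm a b c ρ σ * M.map (PowerSeries.C (R := ℂ))) ∧
      (c : ℚ) / a ≤ f.order + 2 * ((b : ℚ) / a - 1) := by
  have hq : q ≠ 0 := by
    rintro rfl
    exact hG2 (isRankTwoLimit_of_eq_zero hF hFd hp hα (fun h => hne ⟨rfl, h⟩) hG)
  obtain ⟨N, hN, φs, hφs, hprod⟩ := exists_branches hF hFd hα hG
  obtain ⟨a, haq⟩ : ∃ a, q.natTrailingDegree = a := ⟨_, rfl⟩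
  have ha0 : a ≠ 0 := by
    rintro rfl
    rcases Polynomial.natTrailingDegree_eq_zero.1 haq with h | h
    · exact hq h
    · exact h (by rw [Polynomial.coeff_zero_eq_eval_zero, hα.q_zero])
  have hab : a < b := by
    have h1 := Polynomial.natTrailingDegree_le_natDegree q
    have h2 := (Polynomial.natDegree_lt_iff_degree_lt hq).2 hα.degree_q
    omega
  obtain ⟨ν, ν₁, hν₁, hνν, hνq, hν1⟩ := exists_reparametrization hq (haq ▸ ha0) hN
  rw [haq] at hνq hν1
  subst hνν
  obtain ⟨T₁, κ, hκ, hT₁, hTN, hT0⟩ := exists_root_planeY hab hN hν₁ hνq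
  obtain ⟨T, hTT⟩ : ∃ T, T = X ^ a * T₁ := ⟨_, rfl⟩
  rw [← hTT] at hTN hT0
  have hT : constantCoeff T = 0 := by rw [hTT, map_mul, constantCoeff_X_pow ha0, zero_mul]
  have hT' : constantCoeff (map (Polynomial.C (R := ℂ[X])) T) = 0 := by
    rw [← coeff_zero_eq_constantCoeff_apply, coeff_map, coeff_zero_eq_constantCoeff_apply, hT,
      map_zero]
  have hTne : map (Polynomial.C (R := ℂ[X])) T ≠ 0 := by
    have h1 : T ≠ 0 := by
      rw [hTT]
      exact mul_ne_zero (pow_ne_zero _ X_ne_zero) (isUnit_of_constantCoeff_eq_C hκ hT₁).ne_zero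
    exact fun h => h1 (map_injective _ Polynomial.C_injective (h.trans (map_zero _).symm))
  obtain ⟨k, μ, i, j, hk, -, hkμ⟩ := hprod 1 one_ne_zero _ hT' hTne
    (by rw [coordY_eq_map, ← hTN, map_pow])
  obtain ⟨hbc, φ, hφ, hφ0, hd⟩ := exists_branch_of_not_isRankTwoLimit hFd hp hα hG hG2 hq haq ha0
    hab hN φs hT hTT hκ hT₁ hTN hT' hk hkμ
  obtain ⟨hφc, hφF⟩ := hφs φ hφ
  have hη : constantCoeff (X * expand N hN ν₁) = 0 := by simp
  have hχ : constantCoeff (X * ν₁ ^ N) = 0 := by simp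
  set η := X * expand N hN ν₁ with hηdef
  have hηa : constantCoeff (η ^ a) = 0 := by rw [map_pow, hη, zero_pow ha0]
  have hηo : (η ^ a).order = a := by
    rw [order_pow, hηdef, order_X_mul_isUnit (hν₁.map (expand N hN)), nsmul_eq_mul, mul_one]
  have hφN : N < φ.order.toNat :=
    order_lt_of_contact hT hN hTT hTN hα.s_zero hT0 hηa hηo hbc hφ0 hφc hd
  have hineq := contact_inequality hT hN hTT hκ hT₁ hTN hφN hφ0 hd
  have hηN : η ^ N = expand N hN (X * ν₁ ^ N) := by
    rw [hηdef, mul_pow, map_mul, map_pow, expand_X]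
  -- At `y = 0` one has `T = η^a`, and `φ(η^a)` is `φ(X^a)` composed with `η`, the reparametrization
  -- that is undone here.
  obtain ⟨ρ, hρ, hρφ, hρr⟩ := exists_truncation hN c hν₁ hη hχ (r : ℂ⟦X⟧) (expand a ha0 φ) (by
    rw [substHom_expand]
    exact contact_value hT hN hT0 hηa hd)
  obtain ⟨σ, hσ, hσφ, hσs⟩ := exists_truncation hN c hν₁ hη hχ
    ((s : ℂ⟦X⟧) * (X * ν₁ ^ N) ^ b)
    (X ^ (N * (b - a)) * expand a ha0 (C ((N : ℂ)⁻¹) * euler φ)) (by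
    -- Multiplying this congruence by `η^(N (b - a)) / N` turns `ξ^N s` into `s (tν)^b` and raises
    -- the modulus to `X^(N c)`, since `(b - a) + (c - b + a) = c`.
    have h1 := contact_derivative hT hN hTT hTN hT0 hηa hbc hd
    have h2 : (X : ℂ⟦X⟧) ^ (N * (b - a)) ∣ η ^ (N * (b - a)) :=
      pow_dvd_pow_of_dvd (dvd_mul_right _ _) _
    have h3 := (mul_dvd_mul h2 h1).mul_left (C ((N : ℂ)⁻¹))
    rw [← pow_add, ← mul_add, show b - a + (c - b + a) = c by omega] at h3
    refine h3.trans (dvd_of_eq ?_)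
    have hNN : C ((N : ℂ)⁻¹) * (N : ℂ⟦X⟧) = 1 := by
      rw [← map_natCast (C (R := ℂ)), ← map_mul, inv_mul_cancel₀ (Nat.cast_ne_zero.2 hN), map_one]
    have hpow : η ^ (N * (b - a)) * (η ^ a) ^ N = (η ^ N) ^ b := by
      rw [← pow_mul, ← pow_mul, ← pow_add]
      congr 1
      rw [mul_comm a N, ← mul_add, Nat.sub_add_cancel hab.le]
    have hex : expand N hN ((s : ℂ⟦X⟧) * (X * ν₁ ^ N) ^ b) =
        expand N hN (s : ℂ⟦X⟧) * (η ^ N) ^ b := by rw [map_mul, map_pow, hηN]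
    have hsub : substHom η hη
        (X ^ (N * (b - a)) * expand a ha0 (C ((N : ℂ)⁻¹) * euler φ)) =
        η ^ (N * (b - a)) * (C ((N : ℂ)⁻¹) * substHom (η ^ a) hηa (euler φ)) := by
      rw [map_mul, map_pow, substHom_X, substHom_expand, map_mul, substHom_C]
      rfl
    rw [hex, hsub, ← hpow]
    linear_combination (η ^ (N * (b - a)) * (η ^ a) ^ N * expand N hN (s : ℂ⟦X⟧)) * hNN)
  obtain ⟨M, hM, hM1, hequiv⟩ := exists_germEquiv_branchGerm (hν₁.pow N) hχ hνq hρr hσs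
  have hab' : (0 : ℚ) < a := Nat.cast_pos.2 (Nat.pos_of_ne_zero ha0)
  have hN' : (0 : ℚ) < N := Nat.cast_pos.2 (Nat.pos_of_ne_zero hN)
  refine ⟨toPuiseux N hN φ, a, Nat.pos_of_ne_zero ha0, ρ, σ, M,
    isFormalBranch_toPuiseux hN hφF hφN, toPuiseux_ne_zero hN hφ0, ?_, hq, haq, hab, hbc, ?_, ?_,
    hM, fun hqa => ?_, hequiv, ?_⟩
  · rw [order_toPuiseux hN hφ0, one_lt_div hN']
    exact_mod_cast hφN
  · rw [substPow_toPuiseux]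
    exact isTruncation_toPuiseux hN hρ hρφ
  · rw [substPow_fracDeriv_mul hN a b _ hab.le]
    exact isTruncation_toPuiseux hN hσ hσφ
  -- With `ν = 1` the congruences modulo `t^c` compare polynomials of degree less than `c`, so they
  -- are equalities.
  · have hν := hν1 hqa
    have hsub : ∀ f : ℂ⟦X⟧, substHom (X * ν₁ ^ N) hχ f = f := fun f =>
      (substHom_congr (by rw [hν, mul_one]) _ constantCoeff_X f).trans (substHom_coe_X _ f)
    rw [hsub] at hρr hσs
    refine hM1 hν (coe_eq_coe_of_X_pow_dvd hρ hα.degree_r hρr) ?_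
    have h1 := degree_mul_X_pow_lt hbc.le hα.degree_s
    have h2 : ((s * Polynomial.X ^ b : ℂ[X]) : ℂ⟦X⟧) = (s : ℂ⟦X⟧) * X ^ b := by simp
    rw [← h2]
    refine coe_eq_coe_of_X_pow_dvd hσ h1 ?_
    rwa [hν, mul_one, ← h2] at hσs
  · rw [order_toPuiseux hN hφ0]
    have h1 : (N : ℚ) * c + 2 * (N * a) ≤ 2 * (N * b) + a * φ.order.toNat := by
      exact_mod_cast hineq
    have h2 : (φ.order.toNat : ℚ) / N + 2 * ((b : ℚ) / a - 1) - c / a =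
        (2 * (N * b) + a * φ.order.toNat - (N * c + 2 * (N * a))) / (N * a) := by
      field_simp
      ring
    have h3 : 0 ≤ (φ.order.toNat : ℚ) / N + 2 * ((b : ℚ) / a - 1) - c / a := by
      rw [h2]
      exact div_nonneg (by linarith) (by positivity)
    linarith
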